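/- A metric graph $\Gamma$ consists of a finite set $V(\Gamma)=\{V_1,\dots,V_N\}$ of vertices, a set $E(\Gamma)$ of unordered pairs $e_{ij}=\{V_i,V_j\}$ of distinct vertices (edges), and a length $l_{ij}=l_{ji}\in[0,+\infty)$ for each edge $e_{ij}$; its length is $l(\Gamma)=\sum_{e_{ij}\in E(\Gamma)}l_{ij}$, and it is connected if any two vertices are joined by a path of edges. A function $u$ on $\Gamma$ with values in a set $X$ is a family of functions $u_{ij}:[0,l_{ij}]\to X$, one for each oriented edge, with $u_{ji}(x)=u_{ij}(l_{ij}-x)$, whose values $u_{ij}(0)=:u(V_i)$ do not depend on $j$ (a vertex without edges also carries a value $u(V_i)$); it is continuous if every $u_{ij}$ is continuous. Let $H^1(\Gamma)$ be the set of continuous $u:\Gamma\to\mathbb{R}$ with $u_{ij}\in H^1([0,l_{ij}])$ for every edge. For $\mathcal V\subset V(\Gamma)$ put $H^1_0(\Gamma;\mathcal V)=\{u\in H^1(\Gamma): u=0\text{ on }\mathcal V\}$ and define the Dirichlet energy $$\mathcal E(\Gamma;\mathcal V)=\inf\Big\{\sum_{e_{ij}\in E(\Gamma)}\int_0^{l_{ij}}\Big(\tfrac12|u_{ij}'|^2-u_{ij}\Big)\,dx\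 :\ u\in H^1_0(\Gamma;\mathcal V)\Big\},$$ each edge being counted once. An immersion $\gamma:\Gamma\to\mathbb{R}^d$ is a continuous function on $\Gamma$ with values in $\mathbb{R}^d$ such that each $\gamma_{ij}:[0,l_{ij}]\to\mathbb{R}^d$ is an injective curve parametrized by arc length. **Corollary.** Let $k\ge1$, let $D_1,\dots,D_k$ be pairwise disjoint compact sets in $\mathbb{R}^d$, and let $l\ge0$ be such that there exists a closed connected set $C\subset\mathbb{R}^d$ with $\mathcal H^1(C)=l$ that intersects each of $D_1,\dots,D_k$. Consider the pairs $(\Gamma,\mathcal V)$ where $\Gamma$ is a connected metric graph with $l(\Gamma)=l$ and $\mathcal V\subset V(\Gamma)$ is a set of vertices such that there exists an immersion $\gamma:\Gamma\to\mathbb{R}^d$ with the property that for each $j=1,\dots,k$ there is a vertex $v_j\in\mathcal V$ with $\gamma(v_j)\in D_j$. Then there is a pair $(\Gamma,\mathcal V)$ in this class that minimizes $\mathcal E(\Gamma;\mathcal V)$ over the class. -/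

import Mathlib

open Set MeasureTheory
open scoped ENNReal NNReal

noncomputable section

/-- A metric graph: a combinatorial graph on a finite set of vertices, each edge being an unordered
pair of distinct vertices, together with a non-negative length for each edge.  Only the values of
`len` on edges are ever used. -/
structure MetricGraph where
  V : Type
  [fintypeV : Fintype V]
  graph : SimpleGraph V
  len : Sym2 V → ℝ≥0

namespace MetricGraph

instance (Γ : MetricGraph) : Fintype Γ.V := Γ.fintypeV

/-- The length of the edge joining `i` and `j`. -/
def edgeLen (Γ : MetricGraph) (i j : Γ.V) : ℝ := Γ.len s(i, j)

open Classical in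
/-- The sum over the edges of a quantity `f i j` that is symmetric in `i` and `j`: every edge occurs
twice in the double sum, once for each orientation, whence the factor `1 / 2`. -/
def edgeSum (Γ : MetricGraph) (f : Γ.V → Γ.V → ℝ) : ℝ :=
  (1 / 2) * ∑ i, ∑ j, if Γ.graph.Adj i j then f i j else 0

/-- The total length of the metric graph. -/
def totalLength (Γ : MetricGraph) : ℝ := Γ.edgeSum fun i j => Γ.edgeLen i j

/-- A function on a metric graph with values in `X`: a value at each vertex and, for each oriented
edge `(i, j)`, a function on `[0, l_ij]`, such that the two orientations of an edge give the same
function up to reversal, and all the edge functions leaving a vertex start from the value there.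
Values of `edge i j` outside `[0, l_ij]`, or for non-adjacent `i`, `j`, are irrelevant. -/
structure Fn (Γ : MetricGraph) (X : Type*) where
  vert : Γ.V → X
  edge : Γ.V → Γ.V → ℝ → X
  edge_symm : ∀ i j, Γ.graph.Adj i j → ∀ x ∈ Icc 0 (Γ.edgeLen i j),
    edge j i x = edge i j (Γ.edgeLen i j - x)
  edge_zero : ∀ i j, Γ.graph.Adj i j → edge i j 0 = vert i

/-- A function on a metric graph is continuous if it is continuous on each closed edge. -/
def Fn.IsContinuous {Γ : MetricGraph} {X : Type*} [TopologicalSpace X] (u : Γ.Fn X) : Prop :=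
  ∀ i j, Γ.graph.Adj i j → ContinuousOn (u.edge i j) (Icc 0 (Γ.edgeLen i j))

/-- The Sobolev space `H¹([0, L])`, in terms of continuous representatives: the absolutely
continuous functions on `[0, L]` whose (a.e. defined) derivative is square integrable. -/
def MemH1Interval (L : ℝ) (f : ℝ → ℝ) : Prop :=
  AbsolutelyContinuousOnInterval f 0 L ∧ MemLp (deriv f) 2 (volume.restrict (Ioo 0 L))

/-- The Sobolev space `H¹(Γ)`. -/
def Fn.MemH1 {Γ : MetricGraph} (u : Γ.Fn ℝ) : Prop :=
  u.IsContinuous ∧ ∀ i j, Γ.graph.Adj i j → MemH1Interval (Γ.edgeLen i j) (u.edge i j)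

/-- The Sobolev space `H¹₀(Γ; W)` with Dirichlet conditions at the vertices in `W`. -/
def Fn.MemH10 {Γ : MetricGraph} (u : Γ.Fn ℝ) (W : Set Γ.V) : Prop :=
  u.MemH1 ∧ ∀ v ∈ W, u.vert v = 0

/-- The functional `J(u) = 1/2 ∫_Γ |u'|² dx - ∫_Γ u dx`. -/
def Fn.J {Γ : MetricGraph} (u : Γ.Fn ℝ) : ℝ :=
  (1 / 2) * (Γ.edgeSum fun i j => ∫ x in (0 : ℝ)..Γ.edgeLen i j, |deriv (u.edge i j) x| ^ 2)
    - Γ.edgeSum fun i j => ∫ x in (0 : ℝ)..Γ.edgeLen i j, u.edge i j x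

/-- The Dirichlet energy `ℰ(Γ; W) = inf {J(u) : u ∈ H¹₀(Γ; W)}`.  The infimum is taken in the
extended reals, so that it is meaningful without a boundedness assumption. -/
def energy (Γ : MetricGraph) (W : Set Γ.V) : EReal :=
  ⨅ (u : Γ.Fn ℝ) (_ : u.MemH10 W), (u.J : EReal)

/-- An immersion of `Γ` into `ℝ^d`: a continuous map which on each edge is an injective curve
parametrized by arc length. -/
def Fn.IsImmersion {Γ : MetricGraph} {d : ℕ} (γ : Γ.Fn (EuclideanSpace ℝ (Fin d))) : Prop :=
  γ.IsContinuous ∧ ∀ i j, Γ.graph.Adj i j →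
    InjOn (γ.edge i j) (Icc 0 (Γ.edgeLen i j)) ∧
    HasUnitSpeedOn (γ.edge i j) (Icc 0 (Γ.edgeLen i j))

/-- `Γ ∈ Adm(W; D_1, …, D_k)`: some immersion sends, for each `j`, a vertex of `W` into `D_j`. -/
def Adm (Γ : MetricGraph) (W : Set Γ.V) {d k : ℕ} (D : Fin k → Set (EuclideanSpace ℝ (Fin d))) :
    Prop :=
  ∃ γ : Γ.Fn (EuclideanSpace ℝ (Fin d)), γ.IsImmersion ∧ ∀ j, ∃ v ∈ W, γ.vert v ∈ D j

/-- The pairs `(Γ, W)` that compete in the minimization problem: `Γ` is a connected metric graph of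
length `l`, `W` is a set of its vertices, and `Γ ∈ Adm(W; D_1, …, D_k)`. -/
def IsCompetitor {d k : ℕ} (D : Fin k → Set (EuclideanSpace ℝ (Fin d))) (l : ℝ)
    (Γ : MetricGraph) (W : Set Γ.V) : Prop :=
  Γ.graph.Connected ∧ Γ.totalLength = l ∧ Γ.Adm W D

end MetricGraph

end

/-! Minimizing over the graph and the function at once reduces to a finite-dimensional compact
problem about trees.

On an edge of length `l > 0` with end values `a`, `b`, the best function is the parabola with second
derivative -1, of energy (a-b)²/(2l) - l(a+b)/2 - l³/24. The quotient is relaxed to a slack `e` with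
(a-b)² ≤ 2le, a closed condition that survives `l → 0`. Likewise the immersion is remembered only
through the inequality "distance of the end points ≤ length".

Given a competitor and a function `u` on it, keep a spanning tree and trade all other edges for one
hair (a pendant edge with free end) at a vertex where `u` is largest: an edge never does better than
a hair of the same length at one of its ends (`neg_le_edgeCost`), and cubes are superadditive. In
the tree, superfluous leaves move into the hair in the same way, and superfluous vertices with one
child are suppressed (`exists_edgeCost_add`). At most `2 * k + 4` vertices remain, the length is
unchanged and the energy has not increased (`exists_treeValues_le`). Bounds on length and energy
bound all the data of such a tree, so an optimal one exists (`isCompact_treeValues`). Conversely, a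
tree becomes a competitor by realizing each edge as two straight segments of the right total length
(`exists_isCompetitor`).

That trees of length `l` exist follows from nearly optimal covers of `C`: they give trees of length
at most `l + ε` (`exists_isTreeOn_of_isConnected`), compactness gives one of length at most `l`, and
a hair supplies the rest. -/

namespace MetricGraph

/-! ### Energy of a single edge -/

/-- The quadratic inequality behind the minimality of parabolas: a function in `H¹([0, L])` has at
least the energy of the parabola with the same boundary values. -/
theorem sq_sub_le_of_memH1Interval {L : ℝ} (hL : 0 ≤ L) {f : ℝ → ℝ} (hf : MemH1Interval L f) :
    (f 0 - f L) ^ 2 ≤ 2 * L * ((1 / 2) * (∫ x in (0 : ℝ)..L, |deriv f x| ^ 2)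
      - (∫ x in (0 : ℝ)..L, f x) + L * (f 0 + f L) / 2 + L ^ 3 / 24) ∧
    0 ≤ (1 / 2) * (∫ x in (0 : ℝ)..L, |deriv f x| ^ 2)
      - (∫ x in (0 : ℝ)..L, f x) + L * (f 0 + f L) / 2 + L ^ 3 / 24 := by
  obtain ⟨hac, hLp⟩ := hf
  -- Expansion of ∫ (f' - g)² ≥ 0, where g = c - (x - L/2) is the derivative of a parabola with
  -- second derivative -1; the cross term is integrated by parts. The choice c = 0 gives
  -- nonnegativity, and the optimal c, the mean slope, gives the square bound.
  have key : ∀ c : ℝ, 0 ≤ (∫ x in (0 : ℝ)..L, |deriv f x| ^ 2) - 2 * c * (f L - f 0)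
      + L * (f 0 + f L) - 2 * (∫ x in (0 : ℝ)..L, f x) + c ^ 2 * L + L ^ 3 / 12 := by
    intro c
    have hsq : IntervalIntegrable (fun x => deriv f x ^ 2) volume 0 L := by
      rw [intervalIntegrable_iff_integrableOn_Ioo_of_le hL]
      exact hLp.integrable_sq
    have hf' := hac.intervalIntegrable_deriv
    have hg : AbsolutelyContinuousOnInterval (fun x => c - (x - L / 2)) 0 L := by
      refine LipschitzOnWith.absolutelyContinuousOnInterval (K := 1) ?_
      refine LipschitzWith.lipschitzOnWith (LipschitzWith.of_dist_le_mul fun x y => ?_)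
      rw [Real.dist_eq, Real.dist_eq, abs_sub_comm x y]
      apply le_of_eq
      simp only [NNReal.coe_one, one_mul]
      congr 1
      ring
    have hgc : Continuous fun x : ℝ => c - (x - L / 2) := by fun_prop
    have hdg : ∀ x : ℝ, deriv (fun x : ℝ => c - (x - L / 2)) x = -1 := by
      intro x
      have : HasDerivAt (fun x : ℝ => c - (x - L / 2)) (-1) x := by
        simpa using ((hasDerivAt_id x).sub_const (L / 2)).const_sub c
      exact this.deriv
    have hparts := hac.integral_mul_deriv_eq_deriv_mul hg
    simp only [hdg, mul_neg, mul_one, intervalIntegral.integral_neg] at hparts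
    have hgg : ∫ x in (0 : ℝ)..L, (c - (x - L / 2)) ^ 2 = c ^ 2 * L + L ^ 3 / 12 := by
      have h : ∀ x ∈ uIcc (0 : ℝ) L, HasDerivAt (fun x => -(c - (x - L / 2)) ^ 3 / 3)
          ((c - (x - L / 2)) ^ 2) x := by
        intro x _
        have h1 : HasDerivAt (fun x : ℝ => c - (x - L / 2)) (-1) x := by
          simpa using ((hasDerivAt_id x).sub_const (L / 2)).const_sub c
        have h2 : HasDerivAt (fun x : ℝ => -(c - (x - L / 2)) ^ 3 / 3) _ x :=
          ((h1.pow 3).neg).div_const 3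
        refine h2.congr_deriv ?_
        norm_num
      rw [intervalIntegral.integral_eq_sub_of_hasDerivAt h
        ((by fun_prop : Continuous fun x : ℝ => (c - (x - L / 2)) ^ 2).intervalIntegrable _ _)]
      ring
    have hexp : ∫ x in (0 : ℝ)..L, (deriv f x - (c - (x - L / 2))) ^ 2
        = (∫ x in (0 : ℝ)..L, deriv f x ^ 2)
          - 2 * (∫ x in (0 : ℝ)..L, deriv f x * (c - (x - L / 2)))
          + ∫ x in (0 : ℝ)..L, (c - (x - L / 2)) ^ 2 := by
      have hm : IntervalIntegrable (fun x => deriv f x * (c - (x - L / 2))) volume 0 L :=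
        hf'.mul_continuousOn hgc.continuousOn
      rw [← intervalIntegral.integral_const_mul, ← intervalIntegral.integral_sub hsq
        (hm.const_mul 2), ← intervalIntegral.integral_add (hsq.sub (hm.const_mul 2))
        ((by fun_prop : Continuous fun x : ℝ => (c - (x - L / 2)) ^ 2).intervalIntegrable _ _)]
      congr 1
      ext x
      ring
    have hnn : 0 ≤ ∫ x in (0 : ℝ)..L, (deriv f x - (c - (x - L / 2))) ^ 2 :=
      intervalIntegral.integral_nonneg hL fun x _ => sq_nonneg _
    simp only [sq_abs]
    rw [hexp, hgg] at hnn
    linarith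
  set I := ∫ x in (0 : ℝ)..L, |deriv f x| ^ 2
  set K := ∫ x in (0 : ℝ)..L, f x
  rcases hL.eq_or_lt with rfl | hL
  · have h0 := key 0
    constructor
    · simp
    · linarith
  · have h0 := key 0
    have h1 := key ((f L - f 0) / L)
    have h2 : ((f L - f 0) / L) * L = f L - f 0 := by field_simp
    constructor
    · have := mul_nonneg hL.le h1
      generalize (f L - f 0) / L = c at *
      rw [← h2] at this
      have h3 : (f 0 - f L) ^ 2 = (c * L) ^ 2 := by rw [h2]; ring
      rw [h3]
      linarith
    · linarith

/-- The energy of a function on an edge of length `l` with boundary values `a` and `b`, the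
quantity `e` being the excess due to the difference of these values. -/
noncomputable def edgeCost (l e a b : ℝ) : ℝ := e - l * (a + b) / 2 - l ^ 3 / 24

/-- A finite tree with vertex set `S` and root `r`, in terms of the map `p` to the parent. The edge
from `v` to `p v` has length `l v`; `P` is a 1-Lipschitz map on the vertices, `a` is a function on
the vertices, and `e v` bounds the energy of `a` on the edge from `v` to `p v`. The root is its own
parent, by a virtual edge of length zero. -/
structure IsTreeOn {V E : Type*} [PseudoMetricSpace E] (S : Finset V) (r : V) (p : V → V)
    (ρ : V → ℕ) (l e a : V → ℝ) (P : V → E) : Prop where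
  root_mem : r ∈ S
  parent_root : p r = r
  len_root : l r = 0
  slack_root : e r = 0
  parent_mem : ∀ v ∈ S, p v ∈ S
  rank_lt : ∀ v ∈ S, v ≠ r → ρ (p v) < ρ v
  len_nonneg : ∀ v ∈ S, 0 ≤ l v
  slack_nonneg : ∀ v ∈ S, 0 ≤ e v
  sq_le : ∀ v ∈ S, (a v - a (p v)) ^ 2 ≤ 2 * l v * e v
  dist_le : ∀ v ∈ S, dist (P v) (P (p v)) ≤ l v

/-- The right-hand side is the energy of a hair at the end with value `b`: freeing the value at the
other end leads to the optimum `a = b + l ^ 2 / 2`. -/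
theorem neg_le_edgeCost {l e a b : ℝ} (hl : 0 ≤ l) (he : 0 ≤ e) (h : (a - b) ^ 2 ≤ 2 * l * e) :
    -b * l - l ^ 3 / 6 ≤ edgeCost l e a b := by
  unfold edgeCost
  rcases hl.eq_or_lt with rfl | hl
  · simpa using he
  · have h1 : 0 ≤ (2 * l) * (e - l * (a - b) / 2 + l ^ 3 / 8) := by
      nlinarith [sq_nonneg (a - b - l ^ 2 / 2)]
    have h2 := nonneg_of_mul_nonneg_right h1 (by positivity)
    linarith

theorem cube_add_le {s h : ℝ} (hs : 0 ≤ s) (hh : 0 ≤ h) : s ^ 3 + h ^ 3 ≤ (s + h) ^ 3 := by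
  have : 0 ≤ s * h * (s + h) := by positivity
  nlinarith

/-- Two parabolas glued at `b` are one admissible function on the joined edge, so the joint parabola
does at least as well. The slack is forced by the equality of the costs. With a - b = s₁x and b - c
= s₂y, what remains to be shown is that s₁s₂(x - y + (s₁ + s₂)/2)² is nonnegative. -/
theorem exists_edgeCost_add {s₁ s₂ e₁ e₂ a b c : ℝ} (hs₁ : 0 ≤ s₁) (hs₂ : 0 ≤ s₂) (he₁ : 0 ≤ e₁)
    (he₂ : 0 ≤ e₂) (h₁ : (a - b) ^ 2 ≤ 2 * s₁ * e₁) (h₂ : (b - c) ^ 2 ≤ 2 * s₂ * e₂) :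
    ∃ e, 0 ≤ e ∧ (a - c) ^ 2 ≤ 2 * (s₁ + s₂) * e ∧
      edgeCost (s₁ + s₂) e a c = edgeCost s₁ e₁ a b + edgeCost s₂ e₂ b c := by
  refine ⟨e₁ + e₂ + (s₂ * (a - b) - s₁ * (b - c)) / 2 + s₁ * s₂ * (s₁ + s₂) / 8, ?_⟩
  have hsq : ∀ {e : ℝ}, 0 ≤ s₁ + s₂ → (s₁ + s₂ = 0 → 0 ≤ e) → (a - c) ^ 2 ≤ 2 * (s₁ + s₂) * e →
      0 ≤ e := by
    intro e h0 h he
    rcases h0.eq_or_lt with h0 | h0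
    · exact h h0.symm
    · have : 0 ≤ 2 * (s₁ + s₂) * e := (sq_nonneg _).trans he
      exact nonneg_of_mul_nonneg_right this (by positivity)
  have hmain : (a - c) ^ 2 ≤ 2 * (s₁ + s₂) *
      (e₁ + e₂ + (s₂ * (a - b) - s₁ * (b - c)) / 2 + s₁ * s₂ * (s₁ + s₂) / 8) := by
    rcases hs₁.eq_or_lt with rfl | hs₁
    · have : a - b = 0 := by
        have : (a - b) ^ 2 ≤ 0 := by simpa using h₁
        exact pow_eq_zero_iff (two_ne_zero) |>.1 (le_antisymm this (sq_nonneg _))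
      have hab : a = b := by linarith
      subst hab
      have := mul_nonneg hs₂ he₁
      simp only [sub_self, mul_zero, zero_mul, zero_add, zero_div, add_zero]
      linarith
    rcases hs₂.eq_or_lt with rfl | hs₂
    · have : b - c = 0 := by
        have : (b - c) ^ 2 ≤ 0 := by simpa using h₂
        exact pow_eq_zero_iff (two_ne_zero) |>.1 (le_antisymm this (sq_nonneg _))
      have hbc : b = c := by linarith
      subst hbc
      have := mul_nonneg hs₁.le he₂
      simp only [sub_self, mul_zero, zero_mul, zero_div, add_zero]
      linarith
    obtain ⟨x, rfl⟩ : ∃ x, a = b + s₁ * x := ⟨(a - b) / s₁, by field_simp; ring⟩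
    obtain ⟨y, rfl⟩ : ∃ y, c = b - s₂ * y := ⟨(b - c) / s₂, by field_simp; ring⟩
    have h₁' : s₁ * x ^ 2 ≤ 2 * e₁ := by
      have : s₁ * (s₁ * x ^ 2) ≤ s₁ * (2 * e₁) := by linarith [h₁]
      exact le_of_mul_le_mul_left this hs₁
    have h₂' : s₂ * y ^ 2 ≤ 2 * e₂ := by
      have : s₂ * (s₂ * y ^ 2) ≤ s₂ * (2 * e₂) := by linarith [h₂]
      exact le_of_mul_le_mul_left this hs₂
    have hpos : 0 ≤ s₁ * s₂ * ((x - y) + (s₁ + s₂) / 2) ^ 2 := by positivity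
    have h3 := mul_le_mul_of_nonneg_left (add_le_add h₁' h₂') (add_pos hs₁ hs₂).le
    linarith
  refine ⟨hsq (add_nonneg hs₁ hs₂) (fun h => ?_) hmain, hmain, ?_⟩
  · have h1 : s₁ = 0 := by linarith
    have h2 : s₂ = 0 := by linarith
    subst h1 h2
    simp only [zero_mul, sub_self, zero_div, add_zero]
    positivity
  · unfold edgeCost
    ring

/-! ### Reduction of a tree with a hair to boundedly many vertices -/

namespace IsTreeOn

variable {V E : Type*} [PseudoMetricSpace E] [DecidableEq V] {S : Finset V} {r : V} {p : V → V}
  {ρ : V → ℕ} {l e a : V → ℝ} {P : V → E}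

/-- The children of a vertex. -/
def children (S : Finset V) (r : V) (p : V → V) (v : V) : Finset V :=
  (S.erase r).filter fun c => p c = v

theorem sum_card_children (hr : r ∈ S) (hp : ∀ v ∈ S, p v ∈ S) :
    ∑ v ∈ S, (children S r p v).card + 1 = S.card := by
  have h : ∀ c ∈ S.erase r, p c ∈ S := fun c hc => hp c (Finset.mem_of_mem_erase hc)
  unfold children
  rw [← Finset.card_eq_sum_card_fiberwise h, Finset.card_erase_add_one hr]

/-- Counting: the numbers of children add up to `S.card - 1`, so two children at every vertex
outside `Q` and `q` would force `S.card ≤ 2 * Q.card + 1`. The base `q` of the hair is excluded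
because it must not be removed. -/
theorem exists_card_children_le_one (hT : IsTreeOn S r p ρ l e a P) {Q : Finset V}
    {q : V} (hcard : 2 * Q.card + 1 < S.card) :
    ∃ v ∈ S, v ∉ Q ∧ v ≠ q ∧ (children S r p v).card ≤ 1 := by
  by_contra! hcon
  have h1 : ∑ v ∈ S \ insert q Q, 2 ≤ ∑ v ∈ S, (children S r p v).card := by
    refine (Finset.sum_le_sum fun v hv => ?_).trans
      (Finset.sum_le_sum_of_subset Finset.sdiff_subset)
    simp only [Finset.mem_sdiff, Finset.mem_insert, not_or] at hv
    exact hcon v hv.1 hv.2.2 hv.2.1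
  have h2 := sum_card_children hT.root_mem hT.parent_mem
  have h3 := Finset.le_card_sdiff (insert q Q) S
  have h4 := Finset.card_insert_le q Q
  simp only [Finset.sum_const, smul_eq_mul] at h1
  omega

/-- Replacing a childless vertex by a longer hair. -/
theorem erase_leaf (hT : IsTreeOn S r p ρ l e a P) {v : V} (hvr : v ≠ r)
    (hch : children S r p v = ∅) : IsTreeOn (S.erase v) r p ρ l e a P where
  root_mem := Finset.mem_erase.2 ⟨hvr.symm, hT.root_mem⟩
  parent_root := hT.parent_root
  len_root := hT.len_root
  slack_root := hT.slack_root
  parent_mem w hw := by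
    have hwS := Finset.mem_of_mem_erase hw
    refine Finset.mem_erase.2 ⟨fun h => ?_, hT.parent_mem w hwS⟩
    by_cases hwr : w = r
    · subst hwr
      rw [hT.parent_root] at h
      exact hvr h.symm
    · have : w ∈ children S r p v := Finset.mem_filter.2 ⟨Finset.mem_erase.2 ⟨hwr, hwS⟩, h⟩
      simp [hch] at this
  rank_lt w hw := hT.rank_lt w (Finset.mem_of_mem_erase hw)
  len_nonneg w hw := hT.len_nonneg w (Finset.mem_of_mem_erase hw)
  slack_nonneg w hw := hT.slack_nonneg w (Finset.mem_of_mem_erase hw)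
  sq_le w hw := hT.sq_le w (Finset.mem_of_mem_erase hw)
  dist_le w hw := hT.dist_le w (Finset.mem_of_mem_erase hw)

/-- Suppressing a vertex with exactly one child. -/
theorem suppress (hT : IsTreeOn S r p ρ l e a P) {v c : V} (hv : v ∈ S) (hvr : v ≠ r)
    (hch : children S r p v = {c}) :
    ∃ p' l' e', IsTreeOn (S.erase v) r p' ρ l' e' a P ∧
      ∑ w ∈ S.erase v, l' w = ∑ w ∈ S, l w ∧
      ∑ w ∈ S.erase v, edgeCost (l' w) (e' w) (a w) (a (p' w)) =
        ∑ w ∈ S, edgeCost (l w) (e w) (a w) (a (p w)) := by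
  have hc : c ∈ children S r p v := by simp [hch]
  obtain ⟨hc, hpc⟩ := Finset.mem_filter.1 hc
  obtain ⟨hcr, hcS⟩ := Finset.mem_erase.1 hc
  have hcv : c ≠ v := by
    rintro rfl
    have := hT.rank_lt c hcS hcr
    rw [hpc] at this
    exact lt_irrefl _ this
  have huniq : ∀ w ∈ S, w ≠ r → w ≠ c → p w ≠ v := by
    intro w hw hwr hwc h
    have : w ∈ children S r p v := Finset.mem_filter.2 ⟨Finset.mem_erase.2 ⟨hwr, hw⟩, h⟩
    rw [hch, Finset.mem_singleton] at this
    exact hwc this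
  have hpv : p v ≠ v := fun h => by
    have := hT.rank_lt v hv hvr
    rw [h] at this
    exact lt_irrefl _ this
  have hsqc := hT.sq_le c hcS
  have hsqv := hT.sq_le v hv
  rw [hpc] at hsqc
  obtain ⟨e₀, he₀, hsq₀, hcost⟩ := exists_edgeCost_add (hT.len_nonneg c hcS) (hT.len_nonneg v hv)
    (hT.slack_nonneg c hcS) (hT.slack_nonneg v hv) hsqc hsqv
  have hcS' : c ∈ S.erase v := Finset.mem_erase.2 ⟨hcv, hcS⟩
  refine ⟨Function.update p c (p v), Function.update l c (l c + l v), Function.update e c e₀,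
    ?_, ?_, ?_⟩
  · constructor
    · exact Finset.mem_erase.2 ⟨hvr.symm, hT.root_mem⟩
    · rw [Function.update_of_ne hcr.symm, hT.parent_root]
    · rw [Function.update_of_ne hcr.symm, hT.len_root]
    · rw [Function.update_of_ne hcr.symm, hT.slack_root]
    · intro w hw
      obtain ⟨hwv, hwS⟩ := Finset.mem_erase.1 hw
      by_cases hwc : w = c
      · subst hwc
        rw [Function.update_self]
        exact Finset.mem_erase.2 ⟨hpv, hT.parent_mem v hv⟩
      · rw [Function.update_of_ne hwc]
        refine Finset.mem_erase.2 ⟨?_, hT.parent_mem w hwS⟩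
        by_cases hwr : w = r
        · rw [hwr, hT.parent_root]
          exact hvr.symm
        · exact huniq w hwS hwr hwc
    · intro w hw hwr
      have hwS := Finset.mem_of_mem_erase hw
      by_cases hwc : w = c
      · subst hwc
        rw [Function.update_self]
        have := hT.rank_lt w hwS hwr
        rw [hpc] at this
        exact (hT.rank_lt v hv hvr).trans this
      · rw [Function.update_of_ne hwc]
        exact hT.rank_lt w hwS hwr
    · intro w hw
      have hwS := Finset.mem_of_mem_erase hw
      by_cases hwc : w = c
      · subst hwc
        rw [Function.update_self]
        exact add_nonneg (hT.len_nonneg w hwS) (hT.len_nonneg v hv)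
      · rw [Function.update_of_ne hwc]
        exact hT.len_nonneg w hwS
    · intro w hw
      by_cases hwc : w = c
      · subst hwc
        rwa [Function.update_self]
      · rw [Function.update_of_ne hwc]
        exact hT.slack_nonneg w (Finset.mem_of_mem_erase hw)
    · intro w hw
      by_cases hwc : w = c
      · subst hwc
        simpa only [Function.update_self] using hsq₀
      · simp only [Function.update_of_ne hwc]
        exact hT.sq_le w (Finset.mem_of_mem_erase hw)
    · intro w hw
      by_cases hwc : w = c
      · subst hwc
        simp only [Function.update_self]
        have h1 := hT.dist_le w hcS
        have h2 := hT.dist_le v hv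
        rw [hpc] at h1
        exact (dist_triangle _ (P v) _).trans (add_le_add h1 h2)
      · simp only [Function.update_of_ne hwc]
        exact hT.dist_le w (Finset.mem_of_mem_erase hw)
  · rw [← Finset.add_sum_erase _ _ hv, ← Finset.add_sum_erase _ _ hcS',
      ← Finset.add_sum_erase _ _ hcS', Function.update_self, ← add_assoc, add_comm (l c)]
    congr 1
    refine Finset.sum_congr rfl fun w hw => ?_
    rw [Function.update_of_ne (Finset.ne_of_mem_erase hw)]
  · rw [← Finset.add_sum_erase S _ hv, ← Finset.add_sum_erase _ _ hcS',
      ← Finset.add_sum_erase (S.erase v) _ hcS', ← add_assoc]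
    simp only [Function.update_self]
    rw [hcost, hpc, add_comm (edgeCost (l c) _ _ _)]
    congr 1
    refine Finset.sum_congr rfl fun w hw => ?_
    simp only [Function.update_of_ne (Finset.ne_of_mem_erase hw)]

/-- A tree with a hair of length `h` at the vertex `q` can be simplified, without increase of the
energy, to a tree whose number of vertices is bounded in terms of a prescribed set of vertices. -/
theorem exists_card_le {Q : Finset V} (hrQ : r ∈ Q) {q : V} {h : ℝ}
    (hT : IsTreeOn S r p ρ l e a P) (hQ : Q ⊆ S) (hq : q ∈ S) (hh : 0 ≤ h) :
    ∃ (S' : Finset V) (p' : V → V) (l' e' : V → ℝ) (q' : V) (h' : ℝ),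
      IsTreeOn S' r p' ρ l' e' a P ∧ Q ⊆ S' ∧ q' ∈ S' ∧ 0 ≤ h' ∧ S'.card ≤ 2 * Q.card + 1 ∧
      ∑ v ∈ S', l' v + h' = ∑ v ∈ S, l v + h ∧
      ∑ v ∈ S', edgeCost (l' v) (e' v) (a v) (a (p' v)) - a q' * h' - h' ^ 3 / 6 ≤
        ∑ v ∈ S, edgeCost (l v) (e v) (a v) (a (p v)) - a q * h - h ^ 3 / 6 := by
  induction hn : S.card using Nat.strong_induction_on generalizing S p l e q h with
  | _ n ih =>
    subst hn
    by_cases hcard : S.card ≤ 2 * Q.card + 1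
    · exact ⟨S, p, l, e, q, h, hT, hQ, hq, hh, hcard, rfl, le_rfl⟩
    obtain ⟨v, hv, hvQ, hvq, hch⟩ := hT.exists_card_children_le_one (q := q) (not_le.1 hcard)
    have hvr : v ≠ r := fun h => hvQ (h ▸ hrQ)
    have hlt : (S.erase v).card < S.card := Finset.card_erase_lt_of_mem hv
    have hQ' : Q ⊆ S.erase v := fun w hw => Finset.mem_erase.2 ⟨fun h => hvQ (h ▸ hw), hQ hw⟩
    have hq' : q ∈ S.erase v := Finset.mem_erase.2 ⟨hvq.symm, hq⟩
    rcases Nat.le_one_iff_eq_zero_or_eq_one.1 hch with hch | hch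
    · rw [Finset.card_eq_zero] at hch
      have hT' := hT.erase_leaf hvr hch
      have hlv := hT.len_nonneg v hv
      have hpv : p v ∈ S.erase v := Finset.mem_erase.2 ⟨fun h => by
        have := hT.rank_lt v hv hvr
        rw [h] at this
        exact lt_irrefl _ this, hT.parent_mem v hv⟩
      -- The lengths of the removed edge and of the old hair are merged into one hair at whichever
      -- of `p v` and `q` carries the larger value; this lowers the linear terms, and
      -- superadditivity of the cube lowers the cubic one.
      obtain ⟨w, hw, hw1, hw2⟩ : ∃ w ∈ S.erase v, a (p v) ≤ a w ∧ a q ≤ a w := by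
        rcases le_total (a (p v)) (a q) with h | h
        · exact ⟨q, hq', h, le_rfl⟩
        · exact ⟨p v, hpv, le_rfl, h⟩
      obtain ⟨S', p', l', e', q', h', h1, h2, h3, h4, h5, h6, h7⟩ :=
        ih _ hlt hT' hQ' hw (add_nonneg hlv hh) rfl
      refine ⟨S', p', l', e', q', h', h1, h2, h3, h4, h5, ?_, h7.trans ?_⟩
      · rw [h6, ← Finset.add_sum_erase _ _ hv]
        ring
      · rw [← Finset.add_sum_erase S _ hv]
        have h8 := neg_le_edgeCost hlv (hT.slack_nonneg v hv) (hT.sq_le v hv)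
        have h9 := cube_add_le hlv hh
        have h10 := mul_le_mul_of_nonneg_right hw1 hlv
        have h11 := mul_le_mul_of_nonneg_right hw2 hh
        linarith
    · obtain ⟨c, hch⟩ := Finset.card_eq_one.1 hch
      obtain ⟨p₁, l₁, e₁, hT', hl, hc⟩ := hT.suppress hv hvr hch
      obtain ⟨S', p', l', e', q', h', h1, h2, h3, h4, h5, h6, h7⟩ :=
        ih _ hlt hT' hQ' hq' hh rfl
      exact ⟨S', p', l', e', q', h', h1, h2, h3, h4, h5, by rw [h6, hl], by rwa [hc] at h7⟩

end IsTreeOn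

/-! ### Length and energy of trees with `n` vertices -/

/-- The pairs `(length, energy)` of the trees with `n` vertices, some of which are sent to the sets
`D j` and carry the value zero. -/
def treeValues {E : Type*} [PseudoMetricSpace E] {k : ℕ} (D : Fin k → Set E) (n : ℕ) :
    Set (ℝ × ℝ) :=
  {x | ∃ (r : Fin n) (p : Fin n → Fin n) (ρ : Fin n → ℕ) (t : Fin k → Fin n) (l e a : Fin n → ℝ)
    (P : Fin n → E), IsTreeOn Finset.univ r p ρ l e a P ∧ (∀ j, a (t j) = 0 ∧ P (t j) ∈ D j) ∧
    x = (∑ v, l v, ∑ v, edgeCost (l v) (e v) (a v) (a (p v)))}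

theorem IsTreeOn.mem_treeValues {E : Type*} [PseudoMetricSpace E] {k : ℕ} {D : Fin k → Set E}
    {V : Type*} [Fintype V] {r : V} {p : V → V} {ρ : V → ℕ} {l e a : V → ℝ} {P : V → E}
    (hT : IsTreeOn Finset.univ r p ρ l e a P) (t : Fin k → V)
    (ht : ∀ j, a (t j) = 0 ∧ P (t j) ∈ D j) :
    (∑ v, l v, ∑ v, edgeCost (l v) (e v) (a v) (a (p v))) ∈ treeValues D (Fintype.card V) := by
  let f := Fintype.equivFin V
  refine ⟨f r, fun i => f (p (f.symm i)), fun i => ρ (f.symm i), fun j => f (t j),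
    fun i => l (f.symm i), fun i => e (f.symm i), fun i => a (f.symm i), fun i => P (f.symm i),
    ?_, ?_, ?_⟩
  · constructor
    · simp
    · simp [hT.parent_root]
    · simp [hT.len_root]
    · simp [hT.slack_root]
    · simp
    · intro v _ hv
      simp only [Equiv.symm_apply_apply]
      exact hT.rank_lt _ (Finset.mem_univ _) fun h => hv (by rw [← h, Equiv.apply_symm_apply])
    · exact fun v _ => hT.len_nonneg _ (Finset.mem_univ _)
    · exact fun v _ => hT.slack_nonneg _ (Finset.mem_univ _)
    · intro v _
      simpa using hT.sq_le (f.symm v) (Finset.mem_univ _)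
    · intro v _
      simpa using hT.dist_le (f.symm v) (Finset.mem_univ _)
  · intro j
    simpa using ht j
  · simp only [Equiv.symm_apply_apply]
    rw [Equiv.sum_comp f.symm l,
      Equiv.sum_comp f.symm fun v => edgeCost (l v) (e v) (a v) (a (p v))]

/-- Turning a hair into an edge. -/
theorem IsTreeOn.hair_mem_treeValues {E : Type*} [PseudoMetricSpace E] {k : ℕ}
    {D : Fin k → Set E} {V : Type*} {S : Finset V} {r : V} {p : V → V} {ρ : V → ℕ}
    {l e a : V → ℝ} {P : V → E} (hT : IsTreeOn S r p ρ l e a P) (t : Fin k → V)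
    (htS : ∀ j, t j ∈ S) (ht : ∀ j, a (t j) = 0 ∧ P (t j) ∈ D j) {q : V} (hq : q ∈ S) {h : ℝ}
    (hh : 0 ≤ h) :
    (∑ v ∈ S, l v + h,
      ∑ v ∈ S, edgeCost (l v) (e v) (a v) (a (p v)) - a q * h - h ^ 3 / 6) ∈
      treeValues D (S.card + 1) := by
  -- The new vertex `none` is the free end of the hair. Its value `a q + h ^ 2 / 2` is the optimal
  -- one, and the slack `h ^ 3 / 8` makes the square condition an equality. Its position may be `P
  -- q`, since only an upper bound on the distance is required.
  have key : IsTreeOn (V := Option S) Finset.univ (some ⟨r, hT.root_mem⟩)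
      (fun v => v.elim (some ⟨q, hq⟩) fun v => some ⟨p v, hT.parent_mem v v.2⟩)
      (fun v => v.elim (ρ q + 1) fun v => ρ v) (fun v => v.elim h fun v => l v)
      (fun v => v.elim (h ^ 3 / 8) fun v => e v) (fun v => v.elim (a q + h ^ 2 / 2) fun v => a v)
      (fun v => v.elim (P q) fun v => P v) := by
    constructor
    · simp
    · simp [hT.parent_root]
    · simp [hT.len_root]
    · simp [hT.slack_root]
    · simp
    · rintro (_ | v) _ hv
      · simp
      · exact hT.rank_lt v v.2 fun h => hv (by simp [← h])
    · rintro (_ | v) _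
      · exact hh
      · exact hT.len_nonneg v v.2
    · rintro (_ | v) _
      · simp only [Option.elim]
        positivity
      · exact hT.slack_nonneg v v.2
    · rintro (_ | v) _
      · simp only [Option.elim]
        apply le_of_eq
        ring
      · exact hT.sq_le v v.2
    · rintro (_ | v) _
      · simpa using hh
      · exact hT.dist_le v v.2
  have h1 := key.mem_treeValues (fun j => some ⟨t j, htS j⟩) (D := D) ht
  simp only [Fintype.card_option, Fintype.card_coe, Fintype.sum_option, Option.elim] at h1
  rw [Finset.sum_coe_sort S l,
    Finset.sum_coe_sort S fun v => edgeCost (l v) (e v) (a v) (a (p v))] at h1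
  convert h1 using 2
  · ring
  · unfold edgeCost
    ring

/-- Every tree with a hair can be replaced by a tree with at most `2 * k + 4` vertices. -/
theorem IsTreeOn.exists_mem_treeValues {E : Type*} [PseudoMetricSpace E] {k : ℕ}
    {D : Fin k → Set E} {V : Type*} {S : Finset V} {r : V} {p : V → V} {ρ : V → ℕ}
    {l e a : V → ℝ} {P : V → E} (hT : IsTreeOn S r p ρ l e a P) (t : Fin k → V)
    (htS : ∀ j, t j ∈ S) (ht : ∀ j, a (t j) = 0 ∧ P (t j) ∈ D j) {q : V} (hq : q ∈ S) {h : ℝ}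
    (hh : 0 ≤ h) :
    ∃ n ≤ 2 * k + 4, ∃ x ∈ treeValues D n, x.1 = ∑ v ∈ S, l v + h ∧
      x.2 ≤ ∑ v ∈ S, edgeCost (l v) (e v) (a v) (a (p v)) - a q * h - h ^ 3 / 6 := by
  classical
  have hQ : insert r (Finset.univ.image t) ⊆ S := by
    intro v hv
    simp only [Finset.mem_insert, Finset.mem_image, Finset.mem_univ, true_and] at hv
    rcases hv with rfl | ⟨j, rfl⟩
    · exact hT.root_mem
    · exact htS j
  have hQc : (insert r (Finset.univ.image t)).card ≤ k + 1 := by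
    refine (Finset.card_insert_le _ _).trans (Nat.succ_le_succ ?_)
    exact Finset.card_image_le.trans (by simp)
  obtain ⟨S', p', l', e', q', h', h1, h2, h3, h4, h5, h6, h7⟩ :=
    hT.exists_card_le (Finset.mem_insert_self _ _) hQ hq hh
  have htS' : ∀ j, t j ∈ S' := fun j =>
    h2 (Finset.mem_insert_of_mem (Finset.mem_image_of_mem _ (Finset.mem_univ _)))
  -- The prescribed vertices are the root and the `k` terminals, so the count is 2(k + 1) + 1, plus
  -- one for the end of the hair.
  exact ⟨S'.card + 1, by omega, _, h1.hair_mem_treeValues t htS' ht h3 h4, h6, h7⟩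

/-! ### Compactness under bounds on length and energy -/

section Compactness

variable {E : Type*} [NormedAddCommGroup E] {V : Type*} [Fintype V] {r : V} {p : V → V}
  {ρ : V → ℕ}

/-- The rank drops along each edge, so it bounds the number of steps to the root; the sum of the
ranks is a bound independent of `v`. -/
theorem IsTreeOn.dist_root_le {l e a : V → ℝ} {P : V → E} {X : Type*} [PseudoMetricSpace X]
    (hT : IsTreeOn Finset.univ r p ρ l e a P) {f : V → X} {K : ℝ}
    (hf : ∀ v, dist (f v) (f (p v)) ≤ K) (v : V) : dist (f v) (f r) ≤ (∑ v, ρ v : ℕ) * K := by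
  have hK : 0 ≤ K := dist_nonneg.trans (hf r)
  have h : dist (f v) (f r) ≤ ρ v * K := by
    induction hn : ρ v using Nat.strong_induction_on generalizing v with
    | _ n ih =>
      subst hn
      by_cases hv : v = r
      · subst hv
        rw [dist_self]
        positivity
      · have hlt := hT.rank_lt v (Finset.mem_univ _) hv
        have h1 := ih _ hlt (p v) rfl
        have h2 : ((ρ (p v) : ℝ) + 1) * K ≤ ρ v * K := by
          gcongr
          exact_mod_cast hlt
        linarith [dist_triangle (f v) (f (p v)) (f r), hf v]
  refine h.trans ?_
  gcongr
  exact_mod_cast Finset.single_le_sum (f := ρ) (fun _ _ => Nat.zero_le _) (Finset.mem_univ v)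

/-- Bounds on the length and on the energy of a tree bound all the data. -/
theorem exists_bound_of_isTreeOn (r : V) (p : V → V) (ρ : V → ℕ) (s : V) {D : Set E}
    (hD : Bornology.IsBounded D) (Λ B : ℝ) :
    ∃ C : ℝ, ∀ (l e a : V → ℝ) (P : V → E), IsTreeOn Finset.univ r p ρ l e a P → a s = 0 →
      P s ∈ D → ∑ v, l v ≤ Λ → ∑ v, edgeCost (l v) (e v) (a v) (a (p v)) ≤ B →
      ∀ v, ‖l v‖ ≤ C ∧ ‖e v‖ ≤ C ∧ ‖a v‖ ≤ C ∧ ‖P v‖ ≤ C := by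
  obtain ⟨R, hR⟩ := hD.exists_norm_le
  set M : ℝ := ((∑ v, ρ v : ℕ) : ℝ) with hM
  have hM0 : 0 ≤ M := Nat.cast_nonneg _
  set C₁ := 4 * Λ * (|B| + Λ ^ 3) + 16 * M ^ 2 * Λ ^ 4 with hC₁
  refine ⟨max (max Λ (|B| + Λ ^ 3 + 2 * M * Λ * (1 + C₁)))
    (max (2 * M * (1 + C₁)) (R + 2 * M * Λ)), ?_⟩
  intro l e a P hT has hPs hl hB
  have hl0 : ∀ v, 0 ≤ l v := fun v => hT.len_nonneg v (Finset.mem_univ v)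
  have he0 : ∀ v, 0 ≤ e v := fun v => hT.slack_nonneg v (Finset.mem_univ v)
  have hlΛ : ∀ v, l v ≤ Λ := fun v =>
    (Finset.single_le_sum (fun v _ => hl0 v) (Finset.mem_univ v)).trans hl
  have hΛ : 0 ≤ Λ := (Finset.sum_nonneg fun v _ => hl0 v).trans hl
  set F := ∑ v, e v with hF
  have heF : ∀ v, e v ≤ F := fun v => Finset.single_le_sum (fun v _ => he0 v) (Finset.mem_univ v)
  have hF0 : 0 ≤ F := Finset.sum_nonneg fun v _ => he0 v
  -- `K` bounds the jump of `a` along each edge in terms of the total slack `F`. As the energy bound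
  -- controls `F` by a constant plus a multiple of `K`, that is of √F, the estimate closes on
  -- itself.
  set K := √(2 * Λ * F) with hK
  have hK0 : 0 ≤ K := Real.sqrt_nonneg _
  have hKsq : K ^ 2 = 2 * Λ * F := Real.sq_sqrt (by positivity)
  have hstep : ∀ v, dist (a v) (a (p v)) ≤ K := by
    intro v
    rw [Real.dist_eq]
    apply Real.abs_le_sqrt
    refine (hT.sq_le v (Finset.mem_univ v)).trans ?_
    gcongr
    · exact he0 v
    · exact hlΛ v
    · exact heF v
  have ha : ∀ v, |a v| ≤ 2 * M * K := by
    intro v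
    have h1 := hT.dist_root_le hstep v
    have h2 := hT.dist_root_le hstep s
    have h3 := dist_triangle_right (a v) (a s) (a r)
    rw [Real.dist_eq (a v) (a s), has, sub_zero] at h3
    rw [has] at h2
    linarith
  have hP : ∀ v, ‖P v‖ ≤ R + 2 * M * Λ := by
    intro v
    have hst : ∀ v, dist (P v) (P (p v)) ≤ Λ := fun v =>
      (hT.dist_le v (Finset.mem_univ v)).trans (hlΛ v)
    have h1 := hT.dist_root_le hst v
    have h2 := hT.dist_root_le hst s
    have h3 := dist_triangle_right (P v) (P s) (P r)
    have h4 := hR _ hPs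
    have h5 := norm_le_norm_add_norm_sub (P s) (P v)
    rw [← dist_eq_norm'] at h5
    linarith
  have hcost : F ≤ |B| + Λ ^ 3 + 2 * M * Λ * K := by
    have h1 : ∀ v, e v ≤
        edgeCost (l v) (e v) (a v) (a (p v)) + l v * (2 * M * K) + l v * Λ ^ 2 := by
      intro v
      unfold edgeCost
      have h2 : (a v + a (p v)) / 2 ≤ 2 * M * K := by
        have := (abs_le.1 (ha v)).2
        have := (abs_le.1 (ha (p v))).2
        linarith
      have h3 := mul_le_mul_of_nonneg_left h2 (hl0 v)
      have h4 : l v ^ 2 ≤ Λ ^ 2 := by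
        have := hlΛ v
        have := hl0 v
        gcongr
      have h5 := mul_le_mul_of_nonneg_left h4 (hl0 v)
      have h6 : 0 ≤ l v ^ 3 := pow_nonneg (hl0 v) 3
      have h7 : l v * l v ^ 2 = l v ^ 3 := by ring
      linarith
    have h2 := Finset.sum_le_sum fun v (_ : v ∈ Finset.univ) => h1 v
    rw [Finset.sum_add_distrib, Finset.sum_add_distrib, ← Finset.sum_mul, ← Finset.sum_mul] at h2
    have h3 := mul_le_mul_of_nonneg_right hl (by positivity : 0 ≤ 2 * M * K)
    have h4 := mul_le_mul_of_nonneg_right hl (by positivity : 0 ≤ Λ ^ 2)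
    have h5 := le_abs_self B
    linarith
  have hKC : K ≤ 1 + C₁ := by
    have h1 : 2 * Λ * F ≤ 2 * Λ * (|B| + Λ ^ 3 + 2 * M * Λ * K) :=
      mul_le_mul_of_nonneg_left hcost (by positivity)
    -- Young's inequality: the linear term 4MΛ²K is absorbed into K²/2, at the price 8M²Λ⁴; this is
    -- the origin of `C₁`.
    have h2 := sq_nonneg (K - 4 * M * Λ ^ 2)
    have h3 : K ^ 2 ≤ C₁ := by
      rw [← hKsq] at h1
      rw [hC₁]
      linarith
    nlinarith [sq_nonneg (K - 1)]
  intro v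
  refine ⟨?_, ?_, ?_, ?_⟩
  · rw [Real.norm_of_nonneg (hl0 v)]
    exact (hlΛ v).trans ((le_max_left _ _).trans (le_max_left _ _))
  · rw [Real.norm_of_nonneg (he0 v)]
    refine le_trans ((heF v).trans (hcost.trans ?_)) ((le_max_right _ _).trans (le_max_left _ _))
    gcongr
  · rw [Real.norm_eq_abs]
    refine le_trans ((ha v).trans ?_) ((le_max_left _ _).trans (le_max_right _ _))
    gcongr
  · exact (hP v).trans ((le_max_right _ _).trans (le_max_right _ _))

/-- Every condition on the real and spatial data is a non-strict inequality or equation between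
continuous functions. In particular the slack formulation avoids dividing by lengths, so edges may
shrink to zero in the limit. -/
theorem isClosed_setOf_isTreeOn (r : V) (p : V → V) (ρ : V → ℕ) :
    IsClosed {x : (V → ℝ) × (V → ℝ) × (V → ℝ) × (V → E) |
      IsTreeOn Finset.univ r p ρ x.1 x.2.1 x.2.2.1 x.2.2.2} := by
  by_cases h : p r = r ∧ ∀ v, v ≠ r → ρ (p v) < ρ v
  · have : {x : (V → ℝ) × (V → ℝ) × (V → ℝ) × (V → E) |
        IsTreeOn Finset.univ r p ρ x.1 x.2.1 x.2.2.1 x.2.2.2} =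
        ({x | x.1 r = 0} ∩ {x | x.2.1 r = 0}) ∩ ⋂ v, (({x | 0 ≤ x.1 v} ∩ {x | 0 ≤ x.2.1 v}) ∩
          ({x | (x.2.2.1 v - x.2.2.1 (p v)) ^ 2 ≤ 2 * x.1 v * x.2.1 v} ∩
          {x | dist (x.2.2.2 v) (x.2.2.2 (p v)) ≤ x.1 v})) := by
      ext x
      simp only [mem_inter_iff, mem_iInter, mem_ofPred_eq]
      constructor
      · intro hT
        exact ⟨⟨hT.len_root, hT.slack_root⟩, fun v =>
          ⟨⟨hT.len_nonneg v (Finset.mem_univ v), hT.slack_nonneg v (Finset.mem_univ v)⟩,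
            hT.sq_le v (Finset.mem_univ v), hT.dist_le v (Finset.mem_univ v)⟩⟩
      · rintro ⟨⟨h1, h2⟩, h3⟩
        exact ⟨Finset.mem_univ _, h.1, h1, h2, fun _ _ => Finset.mem_univ _, fun v _ => h.2 v,
          fun v _ => (h3 v).1.1, fun v _ => (h3 v).1.2, fun v _ => (h3 v).2.1,
          fun v _ => (h3 v).2.2⟩
    rw [this]
    refine ((isClosed_eq (by fun_prop) (by fun_prop)).inter
      (isClosed_eq (by fun_prop) (by fun_prop))).inter (isClosed_iInter fun v => ?_)
    exact ((isClosed_le (by fun_prop) (by fun_prop)).inter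
      (isClosed_le (by fun_prop) (by fun_prop))).inter
      ((isClosed_le (by fun_prop) (by fun_prop)).inter
      (isClosed_le (by fun_prop) (by fun_prop)))
  · convert isClosed_empty
    rw [eq_empty_iff_forall_notMem]
    exact fun x hT => h ⟨hT.parent_root, fun v => hT.rank_lt v (Finset.mem_univ v)⟩

/-- There are finitely many shapes: root, parent map and choice of terminals. For each one the
admissible data are closed and bounded, and length and energy depend continuously on them. A
terminal, with value zero and position in a bounded set, anchors the bounds; hence `1 ≤ k`. -/
theorem isCompact_treeValues [ProperSpace E] {k : ℕ} (hk : 1 ≤ k) {D : Fin k → Set E}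
    (hD : ∀ j, IsCompact (D j)) (n : ℕ) (Λ B : ℝ) :
    IsCompact (treeValues D n ∩ {x | x.1 ≤ Λ ∧ x.2 ≤ B}) := by
  let Y := (Fin n → ℝ) × (Fin n → ℝ) × (Fin n → ℝ) × (Fin n → E)
  let f : (Fin n → Fin n) → Y → ℝ × ℝ := fun p x =>
    (∑ v, x.1 v, ∑ v, edgeCost (x.1 v) (x.2.1 v) (x.2.2.1 v) (x.2.2.1 (p v)))
  have hf : ∀ p, Continuous (f p) := by
    intro p
    simp only [f, edgeCost, Y]
    fun_prop
  let A : Fin n × (Fin n → Fin n) × (Fin k → Fin n) → Set Y := fun i =>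
    {x | (∃ ρ, IsTreeOn Finset.univ i.1 i.2.1 ρ x.1 x.2.1 x.2.2.1 x.2.2.2) ∧
      (∀ j, x.2.2.1 (i.2.2 j) = 0 ∧ x.2.2.2 (i.2.2 j) ∈ D j) ∧
      (f i.2.1 x).1 ≤ Λ ∧ (f i.2.1 x).2 ≤ B}
  have hA : ∀ i, IsCompact (A i) := by
    rintro ⟨r, p, t⟩
    by_cases hρ : ∃ ρ : Fin n → ℕ, ∀ v, v ≠ r → ρ (p v) < ρ v
    · obtain ⟨ρ, hρ⟩ := hρ
      -- The rank only certifies that the parent map has no cycles, so a single rank serves all the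
      -- data of this shape, although there are infinitely many ranks.
      have hex : ∀ x : Y, (∃ ρ, IsTreeOn Finset.univ r p ρ x.1 x.2.1 x.2.2.1 x.2.2.2) ↔
          IsTreeOn Finset.univ r p ρ x.1 x.2.1 x.2.2.1 x.2.2.2 := fun x =>
        ⟨fun ⟨ρ', h⟩ => { h with rank_lt := fun v _ => hρ v }, fun h => ⟨ρ, h⟩⟩
      refine Metric.isCompact_of_isClosed_isBounded ?_ ?_
      · have : A (r, p, t) = {x | IsTreeOn Finset.univ r p ρ x.1 x.2.1 x.2.2.1 x.2.2.2} ∩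
            ((⋂ j, ({x | x.2.2.1 (t j) = 0} ∩ {x | x.2.2.2 (t j) ∈ D j})) ∩
            ({x | (f p x).1 ≤ Λ} ∩ {x | (f p x).2 ≤ B})) := by
          ext x
          simp only [A, hex, mem_inter_iff, mem_iInter, mem_ofPred_eq]
        rw [this]
        refine (isClosed_setOf_isTreeOn r p ρ).inter (IsClosed.inter (isClosed_iInter fun j => ?_)
          (IsClosed.inter ?_ ?_))
        · refine (isClosed_eq (by fun_prop) (by fun_prop)).inter ?_
          exact (hD j).isClosed.preimage (by fun_prop : Continuous fun x : Y => x.2.2.2 (t j))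
        · exact isClosed_le (hf p).fst continuous_const
        · exact isClosed_le (hf p).snd continuous_const
      · let j₀ : Fin k := ⟨0, hk⟩
        obtain ⟨C, hC⟩ := exists_bound_of_isTreeOn r p ρ (t j₀) (hD j₀).isBounded Λ B
        refine isBounded_iff_forall_norm_le.2 ⟨max C 0, fun x hx => ?_⟩
        obtain ⟨h1, h2, h3, h4⟩ := hx
        have h5 := hC _ _ _ _ ((hex x).1 h1) (h2 j₀).1 (h2 j₀).2 h3 h4
        have h0 : 0 ≤ max C 0 := le_max_right _ _
        refine norm_prod_le_iff.2 ⟨(pi_norm_le_iff_of_nonneg h0).2 fun v => ?_,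
          norm_prod_le_iff.2 ⟨(pi_norm_le_iff_of_nonneg h0).2 fun v => ?_,
          norm_prod_le_iff.2 ⟨(pi_norm_le_iff_of_nonneg h0).2 fun v => ?_,
          (pi_norm_le_iff_of_nonneg h0).2 fun v => ?_⟩⟩⟩
        · exact (h5 v).1.trans (le_max_left _ _)
        · exact (h5 v).2.1.trans (le_max_left _ _)
        · exact (h5 v).2.2.1.trans (le_max_left _ _)
        · exact (h5 v).2.2.2.trans (le_max_left _ _)
    · convert isCompact_empty
      rw [eq_empty_iff_forall_notMem]
      rintro x ⟨⟨ρ, hT⟩, -⟩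
      exact hρ ⟨ρ, fun v => hT.rank_lt v (Finset.mem_univ v)⟩
  have heq : treeValues D n ∩ {x | x.1 ≤ Λ ∧ x.2 ≤ B} = ⋃ i, f i.2.1 '' A i := by
    ext x
    simp only [mem_iUnion, mem_image, mem_inter_iff]
    constructor
    · rintro ⟨⟨r, p, ρ, t, l, e, a, P, hT, ht, rfl⟩, hx⟩
      exact ⟨(r, p, t), (l, e, a, P), ⟨⟨ρ, hT⟩, ht, hx⟩, rfl⟩
    · rintro ⟨⟨r, p, t⟩, ⟨l, e, a, P⟩, ⟨⟨ρ, hT⟩, ht, hx⟩, rfl⟩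
      exact ⟨⟨r, p, ρ, t, l, e, a, P, hT, ht, rfl⟩, hx⟩
  rw [heq]
  exact isCompact_iUnion fun i => (hA i).image (hf i.2.1)

end Compactness

end MetricGraph

/-! ### From a competitor to a tree of bounded size -/

/-- A vertex and the next one on a shortest path to the root. -/
theorem SimpleGraph.exists_parent {V : Type*} (G : SimpleGraph V) (r : V) :
    ∃ p : V → V, p r = r ∧ ∀ v, v ≠ r → G.Reachable r v →
      G.Adj v (p v) ∧ G.Reachable r (p v) ∧ G.dist r (p v) < G.dist r v := by
  classical
  have h : ∀ v, ∃ w, (v = r → w = r) ∧ (v ≠ r → G.Reachable r v →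
      G.Adj v w ∧ G.Reachable r w ∧ G.dist r w < G.dist r v) := by
    intro v
    by_cases hv : v = r
    · exact ⟨r, fun _ => rfl, fun h => absurd hv h⟩
    by_cases hr : G.Reachable r v
    · obtain ⟨w, hw⟩ := hr.symm.exists_walk_length_eq_dist
      cases w with
      | nil => exact absurd rfl hv
      | @cons _ x _ hadj w' =>
        refine ⟨x, fun h => absurd h hv, fun _ _ => ⟨hadj, w'.reachable.symm, ?_⟩⟩
        rw [SimpleGraph.dist_comm, SimpleGraph.dist_comm (u := r), ← hw,
          SimpleGraph.Walk.length_cons]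
        exact Nat.lt_succ_of_le (SimpleGraph.dist_le w')
    · exact ⟨r, fun h => absurd h hv, fun _ h => absurd h hr⟩
  choose p hp using h
  exact ⟨p, (hp r).1 rfl, fun v => (hp v).2⟩

namespace MetricGraph

theorem edgeLen_comm (Γ : MetricGraph) (i j : Γ.V) : Γ.edgeLen i j = Γ.edgeLen j i := by
  unfold edgeLen
  rw [Sym2.eq_swap]

theorem edgeLen_nonneg (Γ : MetricGraph) (i j : Γ.V) : 0 ≤ Γ.edgeLen i j := NNReal.coe_nonneg _

theorem Fn.edge_edgeLen {Γ : MetricGraph} {X : Type*} (u : Γ.Fn X) {i j : Γ.V}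
    (h : Γ.graph.Adj i j) : u.edge i j (Γ.edgeLen i j) = u.vert j := by
  have h1 := u.edge_symm i j h 0 ⟨le_rfl, Γ.edgeLen_nonneg i j⟩
  rw [sub_zero, u.edge_zero j i h.symm] at h1
  exact h1.symm

/-- The length of the edge is the variation of its curve, which dominates the distance of the end
points. This is all that is used of the immersion. -/
theorem Fn.IsImmersion.dist_le {Γ : MetricGraph} {d : ℕ} {γ : Γ.Fn (EuclideanSpace ℝ (Fin d))}
    (hγ : γ.IsImmersion) {i j : Γ.V} (h : Γ.graph.Adj i j) :
    dist (γ.vert i) (γ.vert j) ≤ Γ.edgeLen i j := by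
  have hL := Γ.edgeLen_nonneg i j
  have h0 : (0 : ℝ) ∈ Icc 0 (Γ.edgeLen i j) := ⟨le_rfl, hL⟩
  have h1 : Γ.edgeLen i j ∈ Icc 0 (Γ.edgeLen i j) := ⟨hL, le_rfl⟩
  have hsp := (hγ.2 i j h).2 h0 h1
  have hd := eVariationOn.edist_le (γ.edge i j) (s := Icc 0 (Γ.edgeLen i j) ∩
    Icc 0 (Γ.edgeLen i j)) ⟨h0, h0⟩ ⟨h1, h1⟩
  rw [hsp, γ.edge_zero i j h, γ.edge_edgeLen h, edist_dist] at hd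
  simpa using (ENNReal.ofReal_le_ofReal_iff (by simpa using hL)).1 hd

/-- The contribution of an oriented edge to `J u`. -/
noncomputable def Fn.edgeJ {Γ : MetricGraph} (u : Γ.Fn ℝ) (i j : Γ.V) : ℝ :=
  (1 / 2) * (∫ x in (0 : ℝ)..Γ.edgeLen i j, |deriv (u.edge i j) x| ^ 2)
    - ∫ x in (0 : ℝ)..Γ.edgeLen i j, u.edge i j x

theorem Fn.J_eq_edgeSum {Γ : MetricGraph} (u : Γ.Fn ℝ) : u.J = Γ.edgeSum u.edgeJ := by
  unfold Fn.J edgeSum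
  rw [mul_left_comm, ← mul_sub]
  congr 1
  simp only [Finset.mul_sum, ← Finset.sum_sub_distrib]
  refine Finset.sum_congr rfl fun i _ => Finset.sum_congr rfl fun j _ => ?_
  split_ifs
  · rfl
  · simp

/-- The slack is defined by the equality of the energies; that it is admissible is exactly the
parabola inequality. -/
theorem Fn.MemH1.edgeJ_eq {Γ : MetricGraph} {u : Γ.Fn ℝ} (hu : u.MemH1) {i j : Γ.V}
    (h : Γ.graph.Adj i j) : ∃ e, 0 ≤ e ∧ (u.vert i - u.vert j) ^ 2 ≤ 2 * Γ.edgeLen i j * e ∧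
      u.edgeJ i j = edgeCost (Γ.edgeLen i j) e (u.vert i) (u.vert j) := by
  have h1 := sq_sub_le_of_memH1Interval (Γ.edgeLen_nonneg i j) (hu.2 i j h)
  rw [u.edge_zero i j h, u.edge_edgeLen h] at h1
  refine ⟨_, h1.2, h1.1, ?_⟩
  unfold edgeJ edgeCost
  ring

open Classical in
/-- Splitting a sum over the edges into a sum over the edges of a tree and the others. -/
theorem edgeSum_eq_sum_add (Γ : MetricGraph) {r : Γ.V} {p : Γ.V → Γ.V} {ρ : Γ.V → ℕ}
    (hp : ∀ v, v ≠ r → Γ.graph.Adj v (p v) ∧ ρ (p v) < ρ v) (f : Γ.V → Γ.V → ℝ) :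
    Γ.edgeSum f = (∑ v, if v = r then 0 else (f v (p v) + f (p v) v) / 2) +
      (1 / 2) * ∑ i, ∑ j, if Γ.graph.Adj i j ∧ ¬ (i ≠ r ∧ p i = j) ∧ ¬ (j ≠ r ∧ p j = i)
        then f i j else 0 := by
  -- An oriented edge runs from child to parent, from parent to child, or lies off the tree. The
  -- first two cases exclude each other because the rank decreases towards the root.
  have hsplit : ∀ i j, (if Γ.graph.Adj i j then f i j else 0) =
      (if i ≠ r ∧ p i = j then f i j else 0) + (if j ≠ r ∧ p j = i then f i j else 0) +
      (if Γ.graph.Adj i j ∧ ¬ (i ≠ r ∧ p i = j) ∧ ¬ (j ≠ r ∧ p j = i) then f i j else 0) := by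
    intro i j
    by_cases h1 : i ≠ r ∧ p i = j
    · have h2 : ¬ (j ≠ r ∧ p j = i) := by
        rintro ⟨hj, h2⟩
        have h3 := (hp i h1.1).2
        have h4 := (hp j hj).2
        rw [h1.2] at h3
        rw [h2] at h4
        exact lt_asymm h3 h4
      have h3 : Γ.graph.Adj i j := h1.2 ▸ (hp i h1.1).1
      simp [h1, h2, h3]
    · by_cases h2 : j ≠ r ∧ p j = i
      · have h3 : Γ.graph.Adj i j := h2.2 ▸ (hp j h2.1).1.symm
        rw [if_pos h3, if_neg h1, if_pos h2, if_neg (by tauto)]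
        ring
      · by_cases h3 : Γ.graph.Adj i j
        · rw [if_pos h3, if_neg h1, if_neg h2, if_pos ⟨h3, h1, h2⟩]
          ring
        · rw [if_neg h3, if_neg h1, if_neg h2, if_neg (by tauto)]
          ring
  have h1 : ∑ i, ∑ j, (if i ≠ r ∧ p i = j then f i j else 0) =
      ∑ v, if v = r then 0 else f v (p v) := by
    refine Finset.sum_congr rfl fun i _ => ?_
    by_cases hi : i = r <;> simp [hi]
  have h2 : ∑ i, ∑ j, (if j ≠ r ∧ p j = i then f i j else 0) =
      ∑ v, if v = r then 0 else f (p v) v := by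
    rw [Finset.sum_comm]
    refine Finset.sum_congr rfl fun i _ => ?_
    by_cases hi : i = r <;> simp [hi]
  unfold edgeSum
  simp only [hsplit, Finset.sum_add_distrib]
  rw [h1, h2, mul_add, ← Finset.sum_add_distrib, Finset.mul_sum]
  congr 1
  refine Finset.sum_congr rfl fun v _ => ?_
  split_ifs
  · simp
  · ring

/-- This merges the edges off the tree into one hair of length `h`, half the double sum. Each pair
occurs in both orders, so `x i j ≤ h`, whence `x i j ^ 3 ≤ h ^ 2 * x i j`. -/
theorem sum_cube_le {V : Type*} [Fintype V] {x : V → V → ℝ} (h0 : ∀ i j, 0 ≤ x i j)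
    (hsymm : ∀ i j, x i j = x j i) (hdiag : ∀ i, x i i = 0) :
    (1 / 2) * ∑ i, ∑ j, x i j ^ 3 ≤ ((1 / 2) * ∑ i, ∑ j, x i j) ^ 3 := by
  classical
  set h := (1 / 2) * ∑ i, ∑ j, x i j with hh
  have hle : ∀ i j, x i j ≤ h := by
    intro i j
    by_cases hij : i = j
    · subst hij
      rw [hdiag]
      exact mul_nonneg (by norm_num)
        (Finset.sum_nonneg fun i _ => Finset.sum_nonneg fun j _ => h0 i j)
    · have hne : (i, j) ≠ (j, i) := fun h => hij (Prod.ext_iff.1 h).1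
      have h1 := Finset.sum_le_sum_of_subset_of_nonneg (f := fun y : V × V => x y.1 y.2)
        (Finset.subset_univ {(i, j), (j, i)}) fun y _ _ => h0 _ _
      rw [Finset.sum_pair hne, Fintype.sum_prod_type] at h1
      simp only at h1
      rw [hsymm j i] at h1
      linarith
  have h1 : ∀ i j, x i j ^ 3 ≤ h ^ 2 * x i j := by
    intro i j
    rw [pow_succ]
    have := hle i j
    have := h0 i j
    gcongr
  have h2 : ∑ i, ∑ j, x i j ^ 3 ≤ h ^ 2 * ∑ i, ∑ j, x i j := by
    simp only [Finset.mul_sum]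
    exact Finset.sum_le_sum fun i _ => Finset.sum_le_sum fun j _ => h1 i j
  have h3 : h ^ 3 = h ^ 2 * h := pow_succ h 2
  rw [h3]
  nth_rw 2 [hh]
  linarith

/-- Functions on competitors can be replaced by trees of bounded complexity. -/
theorem exists_treeValues_le {d k : ℕ} (hk : 1 ≤ k) {D : Fin k → Set (EuclideanSpace ℝ (Fin d))}
    {l : ℝ} {Γ : MetricGraph} {W : Set Γ.V} (hΓ : IsCompetitor D l Γ W) {u : Γ.Fn ℝ}
    (hu : u.MemH10 W) :
    ∃ n ≤ 2 * k + 4, ∃ x ∈ treeValues D n, x.1 = l ∧ x.2 ≤ u.J := by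
  classical
  obtain ⟨hconn, hlen, γ, hγ, hterm⟩ := hΓ
  choose t htW htD using hterm
  let r := t ⟨0, hk⟩
  obtain ⟨p, hpr, hp⟩ := Γ.graph.exists_parent r
  have hp' : ∀ v, v ≠ r → Γ.graph.Adj v (p v) ∧ Γ.graph.dist r (p v) < Γ.graph.dist r v :=
    fun v hv => ⟨(hp v hv (hconn r v)).1, (hp v hv (hconn r v)).2.2⟩
  have hE : ∀ i j, ∃ e, Γ.graph.Adj i j → 0 ≤ e ∧
      (u.vert i - u.vert j) ^ 2 ≤ 2 * Γ.edgeLen i j * e ∧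
      u.edgeJ i j = edgeCost (Γ.edgeLen i j) e (u.vert i) (u.vert j) := by
    intro i j
    by_cases h : Γ.graph.Adj i j
    · obtain ⟨e, he⟩ := hu.1.edgeJ_eq h
      exact ⟨e, fun _ => he⟩
    · exact ⟨0, fun h' => absurd h' h⟩
  choose e he using hE
  let R : Γ.V → Γ.V → Prop := fun i j =>
    Γ.graph.Adj i j ∧ ¬ (i ≠ r ∧ p i = j) ∧ ¬ (j ≠ r ∧ p j = i)
  have hRsymm : ∀ i j, R i j ↔ R j i := fun i j => by
    simp only [R]
    rw [Γ.graph.adj_comm]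
    tauto
  let x : Γ.V → Γ.V → ℝ := fun i j => if R i j then Γ.edgeLen i j else 0
  have hx0 : ∀ i j, 0 ≤ x i j := by
    intro i j
    simp only [x]
    split_ifs
    · exact Γ.edgeLen_nonneg i j
    · exact le_rfl
  have hxs : ∀ i j, x i j = x j i := by
    intro i j
    simp only [x, hRsymm i j, Γ.edgeLen_comm i j]
  have hxd : ∀ i, x i i = 0 := fun i => if_neg fun h => Γ.graph.irrefl h.1
  let h := (1 / 2) * ∑ i, ∑ j, x i j
  have hh : 0 ≤ h := mul_nonneg (by norm_num)
    (Finset.sum_nonneg fun i _ => Finset.sum_nonneg fun j _ => hx0 i j)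
  obtain ⟨q, -, hq⟩ := Finset.exists_max_image Finset.univ u.vert ⟨r, Finset.mem_univ r⟩
  let l' : Γ.V → ℝ := fun v => if v = r then 0 else Γ.edgeLen v (p v)
  -- The slacks of the two orientations were chosen independently. Their average is again
  -- admissible, the constraint being linear in the slack, and matches the symmetrized sum over the
  -- edges.
  let e' : Γ.V → ℝ := fun v => if v = r then 0 else (e v (p v) + e (p v) v) / 2
  have hT : IsTreeOn Finset.univ r p (Γ.graph.dist r) l' e' u.vert γ.vert := by
    constructor
    · exact Finset.mem_univ r
    · exact hpr
    · exact if_pos rfl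
    · exact if_pos rfl
    · exact fun _ _ => Finset.mem_univ _
    · exact fun v _ hv => (hp' v hv).2
    · intro v _
      simp only [l']
      split_ifs
      · exact le_rfl
      · exact Γ.edgeLen_nonneg _ _
    · intro v _
      simp only [e']
      split_ifs with hv
      · exact le_rfl
      · have h1 := (he _ _ (hp' v hv).1).1
        have h2 := (he _ _ (hp' v hv).1.symm).1
        linarith
    · intro v _
      simp only [e', l']
      split_ifs with hv
      · simp [hv, hpr]
      · have h1 := (he _ _ (hp' v hv).1).2.1
        have h2 := (he _ _ (hp' v hv).1.symm).2.1
        rw [Γ.edgeLen_comm (p v)] at h2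
        linarith
    · intro v _
      simp only [l']
      split_ifs with hv
      · simp [hv, hpr]
      · exact hγ.dist_le (hp' v hv).1
  obtain ⟨n, hn, y, hy, hy1, hy2⟩ := hT.exists_mem_treeValues t (fun _ => Finset.mem_univ _)
    (D := D) (fun j => ⟨hu.2 _ (htW j), htD j⟩) (Finset.mem_univ q) hh
  refine ⟨n, hn, y, hy, ?_, hy2.trans ?_⟩
  · rw [hy1, ← hlen, totalLength, Γ.edgeSum_eq_sum_add hp']
    congr 1
    refine Finset.sum_congr rfl fun v _ => ?_
    simp only [l']
    split_ifs
    · rfl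
    · rw [Γ.edgeLen_comm (p v)]
      ring
  · rw [u.J_eq_edgeSum, Γ.edgeSum_eq_sum_add hp', sub_sub, sub_eq_add_neg]
    refine add_le_add (Finset.sum_le_sum fun v _ => ?_) ?_
    · simp only [l', e']
      split_ifs with hv
      · simp [edgeCost]
      · rw [(he _ _ (hp' v hv).1).2.2, (he _ _ (hp' v hv).1.symm).2.2, Γ.edgeLen_comm (p v)]
        unfold edgeCost
        apply le_of_eq
        ring
    -- An edge off the tree costs at least as much as a hair at its end `j`, hence as one at `q`,
    -- where `u` is maximal among the vertices.
    · have h1 : ∀ i j, -u.vert q * x i j - x i j ^ 3 / 6 ≤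
          if Γ.graph.Adj i j ∧ ¬ (i ≠ r ∧ p i = j) ∧ ¬ (j ≠ r ∧ p j = i)
          then u.edgeJ i j else 0 := by
        intro i j
        simp only [x, R]
        split_ifs with hij
        · obtain ⟨h2, h3, h4⟩ := he i j hij.1
          rw [h4]
          have h5 := neg_le_edgeCost (Γ.edgeLen_nonneg i j) h2 h3
          have h6 := mul_le_mul_of_nonneg_right (hq j (Finset.mem_univ j)) (Γ.edgeLen_nonneg i j)
          linarith
        · simp
      have h2 := Finset.sum_le_sum fun i (_ : i ∈ Finset.univ) =>
        Finset.sum_le_sum fun j (_ : j ∈ Finset.univ) => h1 i j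
      simp only [Finset.sum_sub_distrib, ← Finset.mul_sum, ← Finset.sum_div] at h2
      have h3 := sum_cube_le hx0 hxs hxd
      have h4 : h = (1 / 2) * ∑ i, ∑ j, x i j := rfl
      rw [← h4] at h3
      have h5 : ∑ i, ∑ j, x i j = 2 * h := by rw [h4]; ring
      rw [h5] at h2
      linarith

end MetricGraph

/-! ### From a tree back to a competitor -/

theorem Isometry.hasUnitSpeedOn {E : Type*} [PseudoEMetricSpace E] {f : ℝ → E} (hf : Isometry f)
    (s : Set ℝ) : HasUnitSpeedOn f s := by
  rw [HasUnitSpeedOn, hasConstantSpeedOnWith_iff_ordered]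
  intro x hx y hy hxy
  rw [NNReal.coe_one, one_mul]
  refine le_antisymm ?_ ?_
  · have h1 := (hf.lipschitz.lipschitzOnWith (s := univ)).comp_eVariationOn_le
      (g := (id : ℝ → ℝ)) (s := s ∩ Icc x y) (mapsTo_univ _ _)
    have h2 := ((monotone_id.monotoneOn s).eVariationOn_eq hx hy).le
    simpa using h1.trans (mul_le_mul_right h2 _)
  · have h1 := eVariationOn.edist_le f (s := s ∩ Icc x y) (x := x) (y := y)
      ⟨hx, le_rfl, hxy⟩ ⟨hy, hxy, le_rfl⟩
    rwa [hf.edist_eq, edist_dist, Real.dist_eq, abs_sub_comm, abs_of_nonneg (sub_nonneg.2 hxy)]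
      at h1

/-- Go from `x` along the line through `y`, past `y` by half of the excess length, and return. If `x
= y`, some direction must exist, which is the role of nontriviality. The detour realizes an edge
longer than the distance of its ends by two injective segments. -/
theorem exists_dist_add_dist_eq {E : Type*} [NormedAddCommGroup E] [NormedSpace ℝ E] {L : ℝ}
    (hL : L = 0 ∨ Nontrivial E) {x y : E} (h : dist x y ≤ L) :
    ∃ z, dist x z + dist z y = L := by
  rcases hL with rfl | hE
  · exact ⟨x, by rw [dist_self, zero_add]; exact le_antisymm h dist_nonneg⟩
  obtain ⟨w, hw, hxy⟩ : ∃ w : E, ‖w‖ = 1 ∧ y = x + dist x y • w := by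
    by_cases hxy : x = y
    · obtain ⟨w, hw⟩ := exists_norm_eq E zero_le_one
      exact ⟨w, hw, by simp [hxy]⟩
    · have hd : dist x y ≠ 0 := dist_ne_zero.2 hxy
      refine ⟨(dist x y)⁻¹ • (y - x), ?_, ?_⟩
      · rw [norm_smul, norm_inv, Real.norm_of_nonneg dist_nonneg, ← dist_eq_norm',
          inv_mul_cancel₀ hd]
      · rw [smul_inv_smul₀ hd, add_sub_cancel]
  have hd0 : 0 ≤ dist x y := dist_nonneg
  generalize dist x y = D at *
  refine ⟨x + ((L + D) / 2) • w, ?_⟩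
  have h2 : x + ((L + D) / 2) • w - y = ((L - D) / 2) • w := by
    rw [hxy, add_sub_add_left_eq_sub, ← sub_smul]
    congr 1
    ring
  rw [dist_self_add_right, dist_eq_norm, h2, norm_smul, norm_smul, hw,
    Real.norm_of_nonneg (by linarith), Real.norm_of_nonneg (by linarith)]
  ring

namespace MetricGraph

section Straight

variable {d : ℕ} {V : Type} [Fintype V]

/-- The metric graph of the segments between points of the Euclidean space. -/
noncomputable abbrev straight (G : SimpleGraph V) (X : V → EuclideanSpace ℝ (Fin d)) :
    MetricGraph where
  V := V
  graph := G
  len := Sym2.lift ⟨fun i j => nndist (X i) (X j), fun i j => nndist_comm (X i) (X j)⟩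

theorem straight_edgeLen (G : SimpleGraph V) (X : V → EuclideanSpace ℝ (Fin d)) (i j : V) :
    (straight G X).edgeLen i j = dist (X i) (X j) := rfl

/-- The immersion of a straight metric graph. -/
noncomputable def straightImmersion (G : SimpleGraph V) (X : V → EuclideanSpace ℝ (Fin d)) :
    (straight G X).Fn (EuclideanSpace ℝ (Fin d)) where
  vert := X
  edge i j x := AffineMap.lineMap (X i) (X j) (x / dist (X i) (X j))
  edge_symm i j _ x hx := by
    rw [straight_edgeLen] at *
    rcases eq_or_ne (dist (X i) (X j)) 0 with h | h
    · simp [dist_eq_zero.1 h]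
    · rw [dist_comm (X j), sub_div, div_self h, AffineMap.lineMap_apply_one_sub]
  edge_zero i j _ := by simp

theorem isImmersion_straightImmersion (G : SimpleGraph V) (X : V → EuclideanSpace ℝ (Fin d)) :
    (straightImmersion G X).IsImmersion := by
  constructor
  · intro i j _
    refine Continuous.continuousOn ?_
    change Continuous fun x : ℝ => AffineMap.lineMap (X i) (X j) (x / dist (X i) (X j))
    fun_prop
  · intro i j _
    rw [straight_edgeLen]
    rcases eq_or_ne (dist (X i) (X j)) 0 with h | h
    · rw [h, Icc_self]
      refine ⟨injOn_singleton _ _, ?_⟩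
      exact hasConstantSpeedOnWith_of_subsingleton _ subsingleton_singleton 1
    · have hiso : Isometry ((straightImmersion G X).edge i j) := by
        refine Isometry.of_dist_eq fun x y => ?_
        change dist (AffineMap.lineMap (X i) (X j) (x / dist (X i) (X j)))
          (AffineMap.lineMap (X i) (X j) (y / dist (X i) (X j))) = dist x y
        rw [dist_lineMap_lineMap, Real.dist_eq, ← sub_div, abs_div, abs_of_nonneg dist_nonneg,
          div_mul_cancel₀ _ h, Real.dist_eq]
      exact ⟨hiso.injective.injOn, hiso.hasUnitSpeedOn _⟩

/-- The function on a straight metric graph that is a parabola with leading coefficient `-1/2` on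
each edge. -/
noncomputable def straightParabola (G : SimpleGraph V) (X : V → EuclideanSpace ℝ (Fin d))
    (a : V → ℝ) (ha : ∀ i j, G.Adj i j → dist (X i) (X j) = 0 → a i = a j) :
    (straight G X).Fn ℝ where
  vert := a
  edge i j x := a i + (a j - a i) * (x / dist (X i) (X j)) + x * (dist (X i) (X j) - x) / 2
  edge_symm i j hij x hx := by
    rw [straight_edgeLen] at *
    rw [dist_comm (X j)]
    rcases eq_or_ne (dist (X i) (X j)) 0 with h | h
    · simp [h, ha i j hij h]
    · field_simp
      ring
  edge_zero i j _ := by simp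

variable {G : SimpleGraph V} {X : V → EuclideanSpace ℝ (Fin d)} {a : V → ℝ}
  (ha : ∀ i j, G.Adj i j → dist (X i) (X j) = 0 → a i = a j)

theorem hasDerivAt_straightParabola (i j : V) (x : ℝ) :
    HasDerivAt ((straightParabola G X a ha).edge i j)
      ((a j - a i) / dist (X i) (X j) + dist (X i) (X j) / 2 - x) x := by
  change HasDerivAt (fun x : ℝ => a i + (a j - a i) * (x / dist (X i) (X j)) +
    x * (dist (X i) (X j) - x) / 2) _ x
  have h1 := (((hasDerivAt_id' x).div_const (dist (X i) (X j))).const_mul (a j - a i)).const_add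
    (a i)
  have h2 := ((hasDerivAt_id' x).fun_mul
    ((hasDerivAt_id' x).const_sub (dist (X i) (X j)))).div_const 2
  refine (h1.fun_add h2).congr_deriv ?_
  ring

theorem continuous_straightParabola (i j : V) :
    Continuous ((straightParabola G X a ha).edge i j) :=
  continuous_iff_continuousAt.2 fun x => (hasDerivAt_straightParabola ha i j x).continuousAt

theorem memH1_straightParabola : (straightParabola G X a ha).MemH1 := by
  refine ⟨fun i j _ => (continuous_straightParabola ha i j).continuousOn, fun i j _ => ⟨?_, ?_⟩⟩
  · apply ContDiffOn.absolutelyContinuousOnInterval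
    apply ContDiff.contDiffOn
    change ContDiff ℝ 1 fun x : ℝ => a i + (a j - a i) * (x / dist (X i) (X j)) +
      x * (dist (X i) (X j) - x) / 2
    fun_prop
  · have hd : deriv ((straightParabola G X a ha).edge i j) =
        fun x => (a j - a i) / dist (X i) (X j) + dist (X i) (X j) / 2 - x :=
      funext fun x => (hasDerivAt_straightParabola ha i j x).deriv
    have hc : Continuous fun x : ℝ =>
        (a j - a i) / dist (X i) (X j) + dist (X i) (X j) / 2 - x := by
      fun_prop
    rw [hd, memLp_two_iff_integrable_sq hc.aestronglyMeasurable]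
    exact ((hc.pow 2).integrableOn_Icc (a := 0) (b := (straight G X).edgeLen i j)).mono_set
      Ioo_subset_Icc_self

/-- The equality case of the parabola inequality. On an edge of length zero both sides vanish, the
slack by the convention `x / 0 = 0`. -/
theorem edgeJ_straightParabola (i j : V) : (straightParabola G X a ha).edgeJ i j =
    edgeCost (dist (X i) (X j)) ((a i - a j) ^ 2 / (2 * dist (X i) (X j))) (a i) (a j) := by
  unfold Fn.edgeJ
  simp only [(hasDerivAt_straightParabola ha i j _).deriv, straight_edgeLen, sq_abs]
  change _ - (∫ x in (0 : ℝ)..dist (X i) (X j), (a i + (a j - a i) * (x / dist (X i) (X j)) +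
    x * (dist (X i) (X j) - x) / 2)) = _
  generalize dist (X i) (X j) = L
  rcases eq_or_ne L 0 with rfl | hL
  · simp [edgeCost]
  have h1 : ∫ x in (0 : ℝ)..L, ((a j - a i) / L + L / 2 - x) ^ 2 =
      (a j - a i) ^ 2 / L + L ^ 3 / 12 := by
    have h : ∀ x ∈ uIcc (0 : ℝ) L, HasDerivAt (fun x => -((a j - a i) / L + L / 2 - x) ^ 3 / 3)
        (((a j - a i) / L + L / 2 - x) ^ 2) x := by
      intro x _
      have h2 : HasDerivAt (fun x : ℝ => -((a j - a i) / L + L / 2 - x) ^ 3 / 3) _ x :=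
        ((((hasDerivAt_id' x).const_sub ((a j - a i) / L + L / 2)).pow 3).neg).div_const 3
      refine h2.congr_deriv ?_
      norm_num
    rw [intervalIntegral.integral_eq_sub_of_hasDerivAt h
      ((by fun_prop : Continuous fun x : ℝ => ((a j - a i) / L + L / 2 - x) ^ 2).intervalIntegrable
        _ _)]
    field_simp
    ring
  have h2 : ∫ x in (0 : ℝ)..L, (a i + (a j - a i) * (x / L) + x * (L - x) / 2) =
      L * (a i + a j) / 2 + L ^ 3 / 12 := by
    have h : ∀ x ∈ uIcc (0 : ℝ) L, HasDerivAt (fun x => a i * x + (a j - a i) / (2 * L) * x ^ 2 +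
        L / 4 * x ^ 2 - x ^ 3 / 6) (a i + (a j - a i) * (x / L) + x * (L - x) / 2) x := by
      intro x _
      have h3 := ((((hasDerivAt_id' x).const_mul (a i)).fun_add
        ((hasDerivAt_pow 2 x).const_mul ((a j - a i) / (2 * L)))).fun_add
        ((hasDerivAt_pow 2 x).const_mul (L / 4))).fun_sub ((hasDerivAt_pow 3 x).div_const 6)
      refine h3.congr_deriv ?_
      field_simp
      norm_num
      ring
    rw [intervalIntegral.integral_eq_sub_of_hasDerivAt h
      ((by fun_prop : Continuous fun x : ℝ => a i + (a j - a i) * (x / L) +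
        x * (L - x) / 2).intervalIntegrable _ _)]
    field_simp
    ring
  rw [h1, h2]
  unfold edgeCost
  field_simp
  ring

end Straight

/-- Cutting an edge at a point, with the optimal value at this point. -/
theorem exists_edgeCost_split {s₁ s₂ e a b : ℝ} (hs₁ : 0 ≤ s₁) (hs₂ : 0 ≤ s₂) (he : 0 ≤ e)
    (h : (a - b) ^ 2 ≤ 2 * (s₁ + s₂) * e) :
    ∃ m, (s₁ = 0 → m = a) ∧ (s₂ = 0 → m = b) ∧
      edgeCost s₁ ((m - a) ^ 2 / (2 * s₁)) m a + edgeCost s₂ ((m - b) ^ 2 / (2 * s₂)) m b ≤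
        edgeCost (s₁ + s₂) e a b := by
  rcases (add_nonneg hs₁ hs₂).eq_or_lt with hs | hs
  · have h1 : s₁ = 0 := by linarith
    have h2 : s₂ = 0 := by linarith
    subst h1 h2
    have : (a - b) ^ 2 ≤ 0 := by simpa using h
    have hab : a - b = 0 := pow_eq_zero_iff two_ne_zero |>.1 (le_antisymm this (sq_nonneg _))
    exact ⟨a, fun _ => rfl, fun _ => by linarith, by simpa [edgeCost] using he⟩
  · obtain ⟨c, rfl⟩ : ∃ c, a = b + (s₁ + s₂) * c := ⟨(a - b) / (s₁ + s₂), by field_simp; ring⟩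
    have he' : (s₁ + s₂) * c ^ 2 / 2 ≤ e := by
      have : (2 * (s₁ + s₂)) * ((s₁ + s₂) * c ^ 2 / 2) ≤ (2 * (s₁ + s₂)) * e := by linarith
      exact le_of_mul_le_mul_left this (by positivity)
    have hdiv : ∀ s y : ℝ, (s * y) ^ 2 / (2 * s) = s * y ^ 2 / 2 := by
      intro s y
      rcases eq_or_ne s 0 with rfl | hs
      · simp
      · field_simp
    -- The value at the cut of the parabola with end values `a` and `b`, where `c` is its mean
    -- slope.
    refine ⟨b + s₂ * (c + s₁ / 2), ?_, ?_, ?_⟩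
    · rintro rfl
      ring
    · rintro rfl
      ring
    · have h1 : b + s₂ * (c + s₁ / 2) - (b + (s₁ + s₂) * c) = s₁ * (s₂ / 2 - c) := by ring
      have h2 : b + s₂ * (c + s₁ / 2) - b = s₂ * (c + s₁ / 2) := by ring
      rw [h1, h2, hdiv, hdiv]
      unfold edgeCost
      linarith

/-- The tree given by the map `p` to the parent, with all the edges divided in two. The vertex in
the middle of the edge from `v` to `p v` is `Sum.inr v`. -/
def subdividedTree {V : Type*} (p : V → V) : SimpleGraph (V ⊕ V) :=
  SimpleGraph.fromRel fun x y => ∃ v, x = Sum.inr v ∧ (y = Sum.inl v ∨ y = Sum.inl (p v))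

theorem subdividedTree_adj_inr_inl {V : Type*} {p : V → V} {v w : V} :
    (subdividedTree p).Adj (Sum.inr v) (Sum.inl w) ↔ w = v ∨ w = p v := by
  simp [subdividedTree]

theorem subdividedTree_connected {V : Type*} {r : V} {p : V → V} {ρ : V → ℕ}
    (hp : ∀ v, v ≠ r → ρ (p v) < ρ v) : (subdividedTree p).Connected := by
  have h1 : ∀ v, (subdividedTree p).Reachable (Sum.inr v) (Sum.inl v) := fun v =>
    (subdividedTree_adj_inr_inl.2 (Or.inl rfl)).reachable
  have h2 : ∀ v, (subdividedTree p).Reachable (Sum.inr v) (Sum.inl (p v)) := fun v =>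
    (subdividedTree_adj_inr_inl.2 (Or.inr rfl)).reachable
  have h3 : ∀ n v, ρ v = n → (subdividedTree p).Reachable (Sum.inl v) (Sum.inl r) := by
    intro n
    induction n using Nat.strong_induction_on with
    | _ n ih =>
      rintro v rfl
      by_cases hv : v = r
      · rw [hv]
      · exact ((h1 v).symm.trans (h2 v)).trans (ih _ (hp v hv) (p v) rfl)
  have h4 : ∀ x, (subdividedTree p).Reachable x (Sum.inl r) := by
    rintro (v | v)
    · exact h3 _ v rfl
    · exact (h1 v).trans (h3 _ v rfl)
  have : Nonempty (V ⊕ V) := ⟨Sum.inl r⟩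
  exact ⟨fun x y => (h4 x).trans (h4 y).symm⟩

-- Where `p v = v` the two halves of the edge at `v` are the same edge of the graph, which must be
-- counted once. Symmetry of `f` matters only between original vertices and midpoints, the graph
-- being bipartite.
open Classical in
theorem edgeSum_subdividedTree {d : ℕ} {V : Type} [Fintype V] {p : V → V}
    {X : V ⊕ V → EuclideanSpace ℝ (Fin d)} {f : V ⊕ V → V ⊕ V → ℝ}
    (hf : ∀ v w, f (Sum.inl v) (Sum.inr w) = f (Sum.inr w) (Sum.inl v)) :
    (straight (subdividedTree p) X).edgeSum f = ∑ v, (f (Sum.inr v) (Sum.inl v) +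
      if p v = v then 0 else f (Sum.inr v) (Sum.inl (p v))) := by
  have hll : ∀ v w, ¬ (subdividedTree p).Adj (Sum.inl v) (Sum.inl w) := by simp [subdividedTree]
  have hrr : ∀ v w, ¬ (subdividedTree p).Adj (Sum.inr v) (Sum.inr w) := by simp [subdividedTree]
  have hlr : ∀ v w, (subdividedTree p).Adj (Sum.inl v) (Sum.inr w) ↔ v = w ∨ v = p w :=
    fun v w => by rw [SimpleGraph.adj_comm, subdividedTree_adj_inr_inl]
  have hsum : ∀ v, ∑ w, (if w = v ∨ w = p v then f (Sum.inr v) (Sum.inl w) else 0) =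
      f (Sum.inr v) (Sum.inl v) + if p v = v then 0 else f (Sum.inr v) (Sum.inl (p v)) := by
    intro v
    by_cases h : p v = v
    · simp [h]
    · have : ∀ w, (if w = v ∨ w = p v then f (Sum.inr v) (Sum.inl w) else 0) =
          (if w = v then f (Sum.inr v) (Sum.inl w) else 0) +
          (if w = p v then f (Sum.inr v) (Sum.inl w) else 0) := by
        intro w
        by_cases h1 : w = v
        · have h2 : w ≠ p v := fun h2 => h (h2 ▸ h1)
          simp [h1, Ne.symm h]
        · simp [h1]
      simp [this, Finset.sum_add_distrib, h]
  have hmain : (straight (subdividedTree p) X).edgeSum f =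
      (1 / 2) * ∑ x : V ⊕ V, ∑ y : V ⊕ V, if (subdividedTree p).Adj x y then f x y else 0 := by
    unfold edgeSum
    rfl
  rw [hmain]
  simp only [Fintype.sum_sum_type, hll, hrr, hlr, subdividedTree_adj_inr_inl, if_false,
    Finset.sum_const_zero, zero_add, add_zero, hsum, hf]
  rw [Finset.sum_comm]
  simp only [hsum]
  ring

/-- Every tree comes from a competitor. -/
theorem exists_isCompetitor {d k n : ℕ} {D : Fin k → Set (EuclideanSpace ℝ (Fin d))} {x : ℝ × ℝ}
    (hx : x ∈ treeValues D n) (hx0 : x.1 = 0 ∨ Nontrivial (EuclideanSpace ℝ (Fin d))) :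
    ∃ (Γ : MetricGraph) (W : Set Γ.V), IsCompetitor D x.1 Γ W ∧ Γ.energy W ≤ (x.2 : EReal) := by
  classical
  obtain ⟨r, p, ρ, t, l, e, a, P, hT, ht, rfl⟩ := hx
  simp only at hx0
  have hl0 : ∀ v, 0 ≤ l v := fun v => hT.len_nonneg v (Finset.mem_univ v)
  have hz : ∀ v, ∃ z, dist (P v) z + dist z (P (p v)) = l v := by
    intro v
    refine exists_dist_add_dist_eq (hx0.imp_left fun h => ?_) (hT.dist_le v (Finset.mem_univ v))
    exact (Finset.sum_eq_zero_iff_of_nonneg fun v _ => hl0 v).1 h v (Finset.mem_univ v)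
  choose z hz using hz
  have hm : ∀ v, ∃ m, (dist (P v) (z v) = 0 → m = a v) ∧ (dist (z v) (P (p v)) = 0 → m = a (p v)) ∧
      edgeCost (dist (P v) (z v)) ((m - a v) ^ 2 / (2 * dist (P v) (z v))) m (a v) +
      edgeCost (dist (z v) (P (p v))) ((m - a (p v)) ^ 2 / (2 * dist (z v) (P (p v)))) m (a (p v)) ≤
        edgeCost (l v) (e v) (a v) (a (p v)) := by
    intro v
    have h := hT.sq_le v (Finset.mem_univ v)
    rw [← hz v] at h ⊢
    exact exists_edgeCost_split dist_nonneg dist_nonneg (hT.slack_nonneg v (Finset.mem_univ v)) h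
  choose m hm1 hm2 hm3 using hm
  let X : Fin n ⊕ Fin n → EuclideanSpace ℝ (Fin d) := Sum.elim P z
  let A : Fin n ⊕ Fin n → ℝ := Sum.elim a m
  have hA' : ∀ v w, (subdividedTree p).Adj (Sum.inr v) (Sum.inl w) →
      dist (X (Sum.inr v)) (X (Sum.inl w)) = 0 → A (Sum.inr v) = A (Sum.inl w) := by
    intro v w h
    rcases subdividedTree_adj_inr_inl.1 h with rfl | rfl
    · rw [dist_comm]
      exact hm1 w
    · exact hm2 v
  have hA : ∀ i j, (subdividedTree p).Adj i j → dist (X i) (X j) = 0 → A i = A j := by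
    rintro (v | v) (w | w) h h0
    · simp [subdividedTree] at h
    · exact (hA' w v h.symm (by rwa [dist_comm])).symm
    · exact hA' v w h h0
    · simp [subdividedTree] at h
  have hpv : ∀ v, p v = v → v = r := by
    intro v hv
    by_contra hvr
    have := hT.rank_lt v (Finset.mem_univ v) hvr
    rw [hv] at this
    exact lt_irrefl _ this
  -- The half-edge that is not counted belongs to the virtual edge at the root and has length zero,
  -- so neither length nor energy is lost.
  have hroot : ∀ v, p v = v → dist (z v) (P (p v)) = 0 := by
    intro v hv
    have h1 := hz v
    have h2 : l v = 0 := by rw [hpv v hv, hT.len_root]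
    have h3 : 0 ≤ dist (P v) (z v) := dist_nonneg
    have h4 : 0 ≤ dist (z v) (P (p v)) := dist_nonneg
    linarith
  refine ⟨straight (subdividedTree p) X, range fun j => Sum.inl (t j), ⟨?_, ?_, ?_⟩, ?_⟩
  · exact subdividedTree_connected fun v => hT.rank_lt v (Finset.mem_univ v)
  · rw [totalLength, edgeSum_subdividedTree]
    · refine Finset.sum_congr rfl fun v _ => ?_
      rw [← hz v]
      split_ifs with hv
      · rw [hroot v hv, straight_edgeLen, dist_comm]
        rfl
      · rw [straight_edgeLen, straight_edgeLen, dist_comm]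
        rfl
    · exact fun v w => edgeLen_comm _ _ _
  · exact ⟨straightImmersion _ X, isImmersion_straightImmersion _ X,
      fun j => ⟨_, mem_range_self j, (ht j).2⟩⟩
  · have hu : (straightParabola (subdividedTree p) X A hA).MemH10
        (range fun j => Sum.inl (t j)) := by
      refine ⟨memH1_straightParabola hA, ?_⟩
      rintro _ ⟨j, rfl⟩
      exact (ht j).1
    refine (iInf₂_le (straightParabola (subdividedTree p) X A hA) hu).trans
      (EReal.coe_le_coe_iff.2 ?_)
    rw [Fn.J_eq_edgeSum, edgeSum_subdividedTree]
    · refine Finset.sum_le_sum fun v _ => le_trans ?_ (hm3 v)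
      rw [edgeJ_straightParabola]
      refine add_le_add ?_ ?_
      · rw [dist_comm]
        rfl
      · split_ifs with hv
        · rw [hroot v hv]
          simp [edgeCost]
        · rw [edgeJ_straightParabola]
          rfl
    · intro v w
      rw [edgeJ_straightParabola, edgeJ_straightParabola, dist_comm]
      unfold edgeCost
      ring

end MetricGraph

/-! ### Short trees from the Hausdorff measure of a connected set -/

/-- A set of finite one-dimensional Hausdorff measure has countable covers by small open sets whose
sum of diameters is almost this measure. -/
theorem exists_isOpen_cover_of_hausdorffMeasure {E : Type*} [MetricSpace E] [MeasurableSpace E]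
    [BorelSpace E] {C : Set E} {l : ℝ} (hl : 0 ≤ l)
    (hC : Measure.hausdorffMeasure 1 C = ENNReal.ofReal l) {δ ε : ℝ} (hδ : 0 < δ) (hε : 0 < ε) :
    ∃ (U : ℕ → Set E) (w : ℕ → ℝ), (∀ n, IsOpen (U n)) ∧ C ⊆ ⋃ n, U n ∧
      (∀ n, ∀ x ∈ U n, ∀ y ∈ U n, dist x y ≤ w n) ∧ (∀ n, 0 ≤ w n) ∧ (∀ n, w n ≤ δ) ∧
      ∀ S : Finset ℕ, ∑ n ∈ S, w n ≤ l + ε := by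
  have hδ2 : 0 < ENNReal.ofReal (δ / 2) := ENNReal.ofReal_pos.2 (by positivity)
  have h1 : (⨅ (t : ℕ → Set E) (_ : C ⊆ ⋃ n, t n)
      (_ : ∀ n, Metric.ediam (t n) ≤ ENNReal.ofReal (δ / 2)),
      ∑' n, ⨆ _ : (t n).Nonempty, Metric.ediam (t n) ^ (1 : ℝ)) < ENNReal.ofReal (l + ε / 2) := by
    refine lt_of_le_of_lt ?_ ((ENNReal.ofReal_lt_ofReal_iff (by positivity)).2
      (by linarith : l < l + ε / 2))
    rw [← hC, Measure.hausdorffMeasure_apply]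
    exact le_iSup₂_of_le (ENNReal.ofReal (δ / 2)) hδ2 le_rfl
  simp only [iInf_lt_iff] at h1
  obtain ⟨t, hCt, htδ, hsum⟩ := h1
  -- Thickening the `n`-th set by `η n` makes it open and adds at most `2 * η n` to its diameter;
  -- the total of the `η n` stays below δ/4 and ε/4, which fits the margins left by δ/2 and ε/2.
  obtain ⟨η, hη0, c, hηc, hc⟩ := NNReal.exists_pos_sum_of_countable
    (ε := (min (δ / 4) (ε / 4)).toNNReal) (by
      rw [Ne, Real.toNNReal_eq_zero, not_le]
      positivity) ℕ
  have hc' : (c : ℝ) < min (δ / 4) (ε / 4) := by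
    rwa [Real.lt_toNNReal_iff_coe_lt] at hc
  have hfin : ∀ n, Metric.ediam (t n) ≠ ∞ := fun n =>
    ne_top_of_le_ne_top ENNReal.ofReal_ne_top (htδ n)
  have hηle : ∀ S : Finset ℕ, ∑ n ∈ S, (η n : ℝ) ≤ c := fun S => by
    exact_mod_cast sum_le_hasSum S (fun _ _ => zero_le) hηc
  refine ⟨fun n => Metric.thickening (η n) (t n),
    fun n => (Metric.ediam (t n)).toReal + 2 * η n, fun n => Metric.isOpen_thickening, ?_, ?_, ?_,
    ?_, ?_⟩
  · exact hCt.trans (iUnion_mono fun n =>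
      Metric.self_subset_thickening (NNReal.coe_pos.2 (hη0 n)) _)
  · intro n x hx y hy
    obtain ⟨x', hx', hxx'⟩ := Metric.mem_thickening_iff.1 hx
    obtain ⟨y', hy', hyy'⟩ := Metric.mem_thickening_iff.1 hy
    have h2 : dist x' y' ≤ (Metric.ediam (t n)).toReal := by
      rw [dist_edist]
      exact ENNReal.toReal_mono (hfin n) (Metric.edist_le_ediam_of_mem hx' hy')
    have h3 := dist_triangle4 x x' y' y
    rw [dist_comm y' y] at h3
    linarith
  · intro n
    positivity
  · intro n
    have h2 : (Metric.ediam (t n)).toReal ≤ δ / 2 :=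
      ENNReal.toReal_le_of_le_ofReal (by positivity) (htδ n)
    have h3 := hηle {n}
    rw [Finset.sum_singleton] at h3
    have h4 := min_le_left (δ / 4) (ε / 4)
    linarith
  · intro S
    have h2 : ∑ n ∈ S, (Metric.ediam (t n)).toReal ≤ l + ε / 2 := by
      rw [← ENNReal.toReal_sum fun n _ => hfin n]
      refine ENNReal.toReal_le_of_le_ofReal (by positivity) (le_trans ?_ hsum.le)
      refine le_trans (Finset.sum_le_sum fun n _ => ?_) (ENNReal.sum_le_tsum S)
      rcases (t n).eq_empty_or_nonempty with h | h
      · simp [h]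
      · simp [h]
    have h3 := hηle S
    have h4 := min_le_right (δ / 4) (ε / 4)
    rw [Finset.sum_add_distrib, ← Finset.mul_sum]
    linarith

namespace MetricGraph

/-- The intersection graph, within a connected set, of an open cover connects all the members that
meet this set. -/
theorem reachable_of_isPreconnected {E ι : Type*} [TopologicalSpace E] {C : Set E}
    (hC : IsPreconnected C) {U : ι → Set E} (hU : ∀ i, IsOpen (U i)) (hCU : C ⊆ ⋃ i, U i) {i j : ι}
    (hi : (C ∩ U i).Nonempty) (hj : (C ∩ U j).Nonempty) :
    (SimpleGraph.fromRel fun i j => (C ∩ (U i ∩ U j)).Nonempty).Reachable i j := by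
  set G := SimpleGraph.fromRel fun i j => (C ∩ (U i ∩ U j)).Nonempty with hG
  by_contra hij
  obtain ⟨x, hxC, hx1, hx2⟩ := hC (⋃ m ∈ {m | G.Reachable i m}, U m)
    (⋃ m ∈ {m | ¬ G.Reachable i m}, U m) (isOpen_biUnion fun m _ => hU m)
    (isOpen_biUnion fun m _ => hU m) (by
      intro x hx
      obtain ⟨m, hm⟩ := mem_iUnion.1 (hCU hx)
      by_cases h : G.Reachable i m
      · exact Or.inl (mem_biUnion (show m ∈ {m | G.Reachable i m} from h) hm)
      · exact Or.inr (mem_biUnion (show m ∈ {m | ¬ G.Reachable i m} from h) hm))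
    (hi.mono (inter_subset_inter_right C
      (subset_biUnion_of_mem (u := U) (show i ∈ {m | G.Reachable i m} from .refl i))))
    (hj.mono (inter_subset_inter_right C
      (subset_biUnion_of_mem (u := U) (show j ∈ {m | ¬ G.Reachable i m} from hij))))
  obtain ⟨m, hm, hxm⟩ := mem_iUnion₂.1 hx1
  obtain ⟨m', hm', hxm'⟩ := mem_iUnion₂.1 hx2
  have hm : G.Reachable i m := hm
  have hm' : ¬ G.Reachable i m' := hm'
  refine hm' (hm.trans (SimpleGraph.Adj.reachable ?_))
  rw [hG, SimpleGraph.fromRel_adj]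
  exact ⟨fun h => hm' (h ▸ hm), Or.inl ⟨x, hxC, hxm, hxm'⟩⟩

/-- The iterated parents of finitely many vertices are finitely many. -/
theorem finite_iterate_parent {V : Type*} {r : V} {p : V → V} {ρ : V → ℕ} {R : Set V}
    (hr : p r = r) (hp : ∀ v ∈ R, v ≠ r → p v ∈ R ∧ ρ (p v) < ρ v) {v : V} (hv : v ∈ R) :
    {w | ∃ m, p^[m] v = w}.Finite := by
  induction hn : ρ v using Nat.strong_induction_on generalizing v with
  | _ n ih =>
    subst hn
    by_cases hvr : v = r
    · refine (finite_singleton r).subset ?_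
      rintro _ ⟨m, rfl⟩
      rw [hvr]
      exact Function.iterate_fixed hr m
    · refine ((ih _ (hp v hv hvr).2 (hp v hv hvr).1 rfl).insert v).subset ?_
      rintro _ ⟨m | m, rfl⟩
      · exact Or.inl rfl
      · exact Or.inr ⟨m, rfl⟩

/-- If all the childless vertices of a tree are among `k` prescribed ones, then the sum over the
edges of the weights of the parents is almost the sum of all the weights. -/
theorem sum_parent_le {V : Type*} [DecidableEq V] {S : Finset V} {r : V} {p : V → V} {k : ℕ}
    (hr : r ∈ S) (hp : ∀ v ∈ S, p v ∈ S) (τ : Fin k → V)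
    (hτ : ∀ v ∈ S, v ≠ r → (∃ j, τ j = v) ∨ (IsTreeOn.children S r p v).Nonempty) {w : V → ℝ}
    {δ : ℝ} (hw0 : ∀ v, 0 ≤ w v) (hwδ : ∀ v, w v ≤ δ) :
    ∑ v ∈ S.erase r, w (p v) ≤ ∑ v ∈ S, w v + k * δ := by
  have hδ : 0 ≤ δ := (hw0 r).trans (hwδ r)
  have h1 : ∑ v ∈ S.erase r, w (p v) = ∑ v ∈ S, (IsTreeOn.children S r p v).card * w v := by
    rw [← Finset.sum_fiberwise_of_maps_to (g := p) (t := S)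
      fun v hv => hp v (Finset.mem_of_mem_erase hv)]
    refine Finset.sum_congr rfl fun v _ => ?_
    rw [← nsmul_eq_mul, ← Finset.sum_const]
    refine Finset.sum_congr rfl fun c hc => ?_
    rw [(Finset.mem_filter.1 hc).2]
  -- A vertex with c ≥ 1 children satisfies c·w ≤ w + (c - 1)δ, and the indicator repairs the case c
  -- = 0. The sum of c - 1 over `S` is -1, and at most `k + 1` vertices are childless, which leaves
  -- `k * δ`.
  have h2 : ∀ v ∈ S, (IsTreeOn.children S r p v).card * w v ≤ w v +
      (((IsTreeOn.children S r p v).card : ℝ) - 1 +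
        if IsTreeOn.children S r p v = ∅ then 1 else 0) * δ := by
    intro v _
    split_ifs with h
    · simpa [h] using hw0 v
    · have h3 : (1 : ℝ) ≤ (IsTreeOn.children S r p v).card := by
        exact_mod_cast Finset.one_le_card.2 (Finset.nonempty_iff_ne_empty.2 h)
      have h4 := mul_le_mul_of_nonneg_left (hwδ v) (sub_nonneg.2 h3)
      linarith
  have h3 : ((S.filter fun v => IsTreeOn.children S r p v = ∅).card : ℝ) ≤ k + 1 := by
    have h4 : (S.filter fun v => IsTreeOn.children S r p v = ∅) ⊆
        insert r (Finset.univ.image τ) := by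
      intro v hv
      obtain ⟨hv, hv'⟩ := Finset.mem_filter.1 hv
      by_cases hvr : v = r
      · exact Finset.mem_insert.2 (Or.inl hvr)
      · rcases hτ v hv hvr with ⟨j, hj⟩ | h
        · exact Finset.mem_insert_of_mem (Finset.mem_image.2 ⟨j, Finset.mem_univ j, hj⟩)
        · simp [hv'] at h
    have h5 : (insert r (Finset.univ.image τ)).card ≤ k + 1 :=
      (Finset.card_insert_le _ _).trans (Nat.succ_le_succ (Finset.card_image_le.trans (by simp)))
    exact_mod_cast (Finset.card_le_card h4).trans h5
  have h4 : (∑ v ∈ S, ((IsTreeOn.children S r p v).card : ℝ)) + 1 = S.card := by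
    exact_mod_cast IsTreeOn.sum_card_children hr hp
  have h5 := Finset.sum_le_sum h2
  rw [Finset.sum_add_distrib, ← Finset.sum_mul, Finset.sum_add_distrib, Finset.sum_sub_distrib,
    Finset.sum_boole, Finset.sum_const, nsmul_eq_mul, mul_one] at h5
  rw [h1]
  refine h5.trans ?_
  gcongr
  linarith

/-- Finitely many points of a connected set can be joined by a tree which is not essentially longer
than the one-dimensional Hausdorff measure of the set. -/
theorem exists_isTreeOn_of_isConnected {E : Type*} [MetricSpace E] [MeasurableSpace E]
    [BorelSpace E] {C : Set E} (hC : IsConnected C) {l : ℝ} (hl : 0 ≤ l)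
    (hCl : Measure.hausdorffMeasure 1 C = ENNReal.ofReal l) {k : ℕ} (hk : 1 ≤ k) {x : Fin k → E}
    (hx : ∀ j, x j ∈ C) {ε : ℝ} (hε : 0 < ε) :
    ∃ (S : Finset (ℕ ⊕ Fin k)) (r : ℕ ⊕ Fin k) (p : ℕ ⊕ Fin k → ℕ ⊕ Fin k) (ρ : ℕ ⊕ Fin k → ℕ)
      (len : ℕ ⊕ Fin k → ℝ) (P : ℕ ⊕ Fin k → E),
      IsTreeOn S r p ρ len (fun _ => 0) (fun _ => 0) P ∧ (∀ j, Sum.inr j ∈ S) ∧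
      (∀ j, P (Sum.inr j) = x j) ∧ ∑ v ∈ S, len v ≤ l + ε := by
  classical
  obtain ⟨U, w, hUo, hCU, hUw, hw0, hwδ, hsum⟩ := exists_isOpen_cover_of_hausdorffMeasure hl hCl
    (by positivity : 0 < ε / (4 * k)) (by positivity : 0 < ε / 2)
  have hτ : ∀ j, ∃ n, x j ∈ U n := fun j => mem_iUnion.1 (hCU (hx j))
  choose τ hτ using hτ
  set G := SimpleGraph.fromRel fun i j => (C ∩ (U i ∩ U j)).Nonempty with hG
  let j₀ : Fin k := ⟨0, hk⟩
  let r := τ j₀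
  have hreach : ∀ j, G.Reachable r (τ j) := fun j =>
    reachable_of_isPreconnected hC.isPreconnected hUo hCU ⟨x j₀, hx j₀, hτ j₀⟩ ⟨x j, hx j, hτ j⟩
  obtain ⟨p, hpr, hp⟩ := G.exists_parent r
  let R : Set ℕ := {v | G.Reachable r v}
  have hpR : ∀ v ∈ R, v ≠ r → p v ∈ R ∧ G.dist r (p v) < G.dist r v := fun v hv hvr =>
    (hp v hvr hv).2
  -- Only the cover members on the paths from the terminals to the root are kept, so every childless
  -- one except possibly the root contains a terminal.
  have hfin : (⋃ j, {v | ∃ m, p^[m] (τ j) = v}).Finite :=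
    finite_iUnion fun j => finite_iterate_parent hpr hpR (hreach j)
  let S := hfin.toFinset
  have hS : ∀ {v}, v ∈ S ↔ ∃ j m, p^[m] (τ j) = v := by
    intro v
    simp [S]
  have hSR : ∀ v ∈ S, v ∈ R := by
    intro v hv
    obtain ⟨j, m, rfl⟩ := hS.1 hv
    induction m with
    | zero => exact hreach j
    | succ m ih =>
      rw [Function.iterate_succ_apply']
      have h := ih (hS.2 ⟨j, m, rfl⟩)
      by_cases hvr : p^[m] (τ j) = r
      · rw [hvr, hpr]
        exact SimpleGraph.Reachable.refl r
      · exact (hpR _ h hvr).1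
  have hτS : ∀ j, τ j ∈ S := fun j => hS.2 ⟨j, 0, rfl⟩
  have hpS : ∀ v ∈ S, p v ∈ S := by
    intro v hv
    obtain ⟨j, m, rfl⟩ := hS.1 hv
    exact hS.2 ⟨j, m + 1, Function.iterate_succ_apply' _ _ _⟩
  have hchild : ∀ v ∈ S, v ≠ r → (∃ j, τ j = v) ∨ (IsTreeOn.children S r p v).Nonempty := by
    intro v hv hvr
    obtain ⟨j, m | m, rfl⟩ := hS.1 hv
    · exact Or.inl ⟨j, rfl⟩
    · rw [Function.iterate_succ_apply'] at *
      refine Or.inr ⟨p^[m] (τ j), Finset.mem_filter.2 ⟨Finset.mem_erase.2 ⟨fun h => ?_,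
        hS.2 ⟨j, m, rfl⟩⟩, rfl⟩⟩
      rw [h, hpr] at hvr
      exact hvr rfl
  -- A member other than the root is represented by a point common to it and its parent. Then `c v`
  -- and `c (p v)` both lie in `U (p v)`, so this edge costs at most `w (p v)`.
  have hc : ∀ v, ∃ y, (v = r → y ∈ U r) ∧ (v ≠ r → v ∈ R → y ∈ U v ∧ y ∈ U (p v)) := by
    intro v
    by_cases hvr : v = r
    · exact ⟨x j₀, fun _ => hτ j₀, fun h => absurd hvr h⟩
    · by_cases hv : v ∈ R
      · have h := (hp v hvr hv).1
        rw [hG, SimpleGraph.fromRel_adj] at h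
        rcases h.2 with ⟨y, -, h1, h2⟩ | ⟨y, -, h1, h2⟩
        · exact ⟨y, fun h => absurd h hvr, fun _ _ => ⟨h1, h2⟩⟩
        · exact ⟨y, fun h => absurd h hvr, fun _ _ => ⟨h2, h1⟩⟩
      · exact ⟨x j₀, fun h => absurd h hvr, fun _ h => absurd h hv⟩
  choose c hc1 hc2 using hc
  have hcU : ∀ v ∈ S, c v ∈ U v := by
    intro v hv
    by_cases hvr : v = r
    · subst hvr
      exact hc1 _ rfl
    · exact (hc2 v hvr (hSR v hv)).1
  let p' : ℕ ⊕ Fin k → ℕ ⊕ Fin k := Sum.elim (fun v => Sum.inl (p v)) fun j => Sum.inl (τ j)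
  let P : ℕ ⊕ Fin k → E := Sum.elim c x
  refine ⟨S.disjSum Finset.univ, Sum.inl r, p',
    Sum.elim (G.dist r) fun j => G.dist r (τ j) + 1, fun v => dist (P v) (P (p' v)), P,
    ⟨?_, ?_, ?_, rfl, ?_, ?_, ?_, ?_, ?_, ?_⟩, ?_, fun j => rfl, ?_⟩
  · exact Finset.inl_mem_disjSum.2 (hτS j₀)
  · simp [p', hpr]
  · simp [p', hpr]
  · rintro (v | j) hv
    · exact Finset.inl_mem_disjSum.2 (hpS v (Finset.inl_mem_disjSum.1 hv))
    · exact Finset.inl_mem_disjSum.2 (hτS j)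
  · rintro (v | j) hv hvr
    · exact (hpR v (hSR v (Finset.inl_mem_disjSum.1 hv)) fun h => hvr (by rw [h])).2
    · exact Nat.lt_succ_self _
  · exact fun _ _ => dist_nonneg
  · exact fun _ _ => le_rfl
  · intro v _
    simp
  · exact fun _ _ => le_rfl
  · intro j
    exact Finset.inr_mem_disjSum.2 (Finset.mem_univ j)
  · rw [Finset.sum_disjSum]
    -- With diameters at most ε/(4k), the edges between members exceed the sum of the `w v` by at
    -- most ε/4, and attaching the `k` terminals as leaves costs another ε/4; the cover itself
    -- contributed ε/2.
    have h1 : ∑ v ∈ S, dist (c v) (c (p v)) ≤ ∑ v ∈ S, w v + k * (ε / (4 * k)) := by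
      refine le_trans ?_ (sum_parent_le (hτS j₀) hpS τ hchild hw0 hwδ)
      rw [← Finset.add_sum_erase S _ (hτS j₀)]
      have h0 : dist (c (τ j₀)) (c (p (τ j₀))) = 0 := by
        change dist (c r) (c (p r)) = 0
        rw [hpr, dist_self]
      rw [h0, zero_add]
      refine Finset.sum_le_sum fun v hv => ?_
      obtain ⟨hvr, hv⟩ := Finset.mem_erase.1 hv
      exact hUw _ _ (hc2 v hvr (hSR v hv)).2 _ (hcU _ (hpS v hv))
    have h2 : ∑ j : Fin k, dist (x j) (c (τ j)) ≤ k * (ε / (4 * k)) := by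
      refine (Finset.sum_le_sum fun j _ =>
        (hUw (τ j) _ (hτ j) _ (hcU _ (hτS j))).trans (hwδ _)).trans ?_
      simp
    have h3 : (k : ℝ) * (ε / (4 * k)) = ε / 4 := by
      have : (k : ℝ) ≠ 0 := by positivity
      field_simp
    have h4 := hsum S
    rw [h3] at h1 h2
    change ∑ v ∈ S, dist (c v) (c (p v)) + ∑ j : Fin k, dist (x j) (c (τ j)) ≤ l + ε
    linarith

end MetricGraph

/-! ### Existence of a minimizer -/

theorem mainTheorem9 {d k : ℕ} (hk : 1 ≤ k)
    (D : Fin k → Set (EuclideanSpace ℝ (Fin d)))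
    (hDcompact : ∀ j, IsCompact (D j))
    (hDdisj : ∀ i j, i ≠ j → Disjoint (D i) (D j))
    (l : ℝ) (hl : 0 ≤ l)
    (hC : ∃ C : Set (EuclideanSpace ℝ (Fin d)), IsClosed C ∧ IsConnected C ∧
      MeasureTheory.Measure.hausdorffMeasure 1 C = ENNReal.ofReal l ∧
      ∀ j, (C ∩ D j).Nonempty) :
    ∃ (Γ : MetricGraph) (W : Set Γ.V), MetricGraph.IsCompetitor D l Γ W ∧
      ∀ (Γ' : MetricGraph) (W' : Set Γ'.V), MetricGraph.IsCompetitor D l Γ' W' →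
        Γ.energy W ≤ Γ'.energy W' := by
  obtain ⟨C, -, hCc, hCl, hCD⟩ := hC
  choose x hxC hxD using hCD
  have hcompact : ∀ N Λ B, IsCompact (⋃ n ∈ Finset.range N,
      MetricGraph.treeValues D n ∩ {x | x.1 ≤ Λ ∧ x.2 ≤ B}) := fun N Λ B =>
    (Finset.range N).isCompact_biUnion fun n _ =>
      MetricGraph.isCompact_treeValues hk hDcompact n Λ B
  have happrox : ∀ ε, 0 < ε → ε ≤ 1 → ∃ y ∈ ⋃ n ∈ Finset.range (2 * k + 5),
      MetricGraph.treeValues D n ∩ {x | x.1 ≤ l + 1 ∧ x.2 ≤ 0}, y.1 ≤ l + ε := by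
    intro ε hε hε1
    obtain ⟨S, r, p, ρ, len, P, hT, hS, hP, hlen⟩ :=
      MetricGraph.exists_isTreeOn_of_isConnected hCc hl hCl hk hxC hε
    obtain ⟨n, hn, y, hy, hy1, hy2⟩ := hT.exists_mem_treeValues (fun j => Sum.inr j) hS (D := D)
      (fun j => ⟨rfl, by rw [hP]; exact hxD j⟩) hT.root_mem le_rfl
    rw [add_zero] at hy1
    refine ⟨y, mem_biUnion (Finset.mem_range.2 (by omega)) ⟨hy, by linarith, hy2.trans ?_⟩,
      by linarith⟩
    have h : ∑ v ∈ S, MetricGraph.edgeCost (len v) 0 0 0 ≤ 0 := by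
      refine Finset.sum_nonpos fun v hv => ?_
      have := pow_nonneg (hT.len_nonneg v hv) 3
      unfold MetricGraph.edgeCost
      linarith
    simpa using h
  -- The least length among these trees is attained, so the excess `ε` disappears.
  obtain ⟨y, hy, hymin⟩ := (hcompact (2 * k + 5) (l + 1) 0).exists_isMinOn
    ((happrox 1 one_pos le_rfl).imp fun _ h => h.1) continuous_fst.continuousOn
  have hyl : y.1 ≤ l := by
    refine le_of_forall_pos_le_add fun ε hε => ?_
    obtain ⟨z, hz, hz1⟩ := happrox (min ε 1) (by positivity) (min_le_right _ _)
    have h1 : y.1 ≤ z.1 := hymin hz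
    have h2 := min_le_left ε 1
    linarith
  -- A hair at the root brings the length to exactly `l`. It adds one vertex to at most `2 * k + 4`,
  -- hence the range `2 * k + 6`.
  obtain ⟨y', n', hn', hy', hy'l⟩ : ∃ y', ∃ n' < 2 * k + 6,
      y' ∈ MetricGraph.treeValues D n' ∧ y'.1 = l := by
    obtain ⟨n, hn, ⟨r, p, ρ, t, len, e, a, P, hT, ht, rfl⟩, -⟩ := mem_iUnion₂.1 hy
    have h := hT.hair_mem_treeValues t (fun _ => Finset.mem_univ _) ht hT.root_mem
      (sub_nonneg.2 hyl)
    have hn := Finset.mem_range.1 hn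
    refine ⟨_, _, ?_, h, add_sub_cancel _ _⟩
    rw [Finset.card_univ, Fintype.card_fin]
    omega
  -- The energy is minimized among trees of length `l` with energy at most that of `y'`. The cutoff
  -- provides compactness and is harmless: anything above it is beaten by `z` anyway.
  obtain ⟨z, ⟨hz, hzl⟩, hzmin⟩ := ((hcompact (2 * k + 6) l y'.2).inter_right
    (isClosed_eq continuous_fst (continuous_const (y := l)))).exists_isMinOn
    ⟨y', mem_biUnion (Finset.mem_range.2 hn') ⟨hy', hy'l.le, le_rfl⟩, hy'l⟩
    continuous_snd.continuousOn
  have hzl : z.1 = l := hzl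
  obtain ⟨n, hn, hzn, hz2⟩ := mem_iUnion₂.1 hz
  -- If the ambient space is a single point, `C` has measure zero and `l = 0`, so no direction for
  -- detours is needed.
  have hnt : z.1 = 0 ∨ Nontrivial (EuclideanSpace ℝ (Fin d)) := by
    rcases subsingleton_or_nontrivial (EuclideanSpace ℝ (Fin d)) with h | h
    · left
      have := Measure.nullSingletonClass_hausdorff (EuclideanSpace ℝ (Fin d)) one_pos
      rw [(subsingleton_of_subsingleton : C.Subsingleton).measure_zero] at hCl
      rw [hzl]
      exact le_antisymm (ENNReal.ofReal_eq_zero.1 hCl.symm) hl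
    · exact Or.inr h
  obtain ⟨Γ, W, hΓ, hE⟩ := MetricGraph.exists_isCompetitor hzn hnt
  rw [hzl] at hΓ
  refine ⟨Γ, W, hΓ, fun Γ' W' hΓ' => le_iInf₂ fun u hu => ?_⟩
  obtain ⟨m, hm, v, hv, hvl, hvJ⟩ := MetricGraph.exists_treeValues_le hk hΓ' hu
  refine hE.trans (EReal.coe_le_coe_iff.2 (le_trans ?_ hvJ))
  rcases le_total v.2 y'.2 with h | h
  · exact hzmin ⟨mem_biUnion (Finset.mem_range.2 (by omega)) ⟨hv, hvl.le, h⟩, hvl⟩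
  · exact hz2.2.trans h
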